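/- **Setting.** Let $\lambda$ be a positive measure on a measurable space $\mathcal X$, let $s_1,\dots,s_L$ be probability densities with respect to $\lambda$, and let $X_l^i$ ($1\le l\le L$, $1\le i\le n_l$) be independent random variables, $X_l^i$ having density $s_l$; put $n=\sum_l n_l\ge 1$. (The categorical case is $\mathcal X=\{1,\dots,B\}$ with $\lambda$ the counting measure.) A model $\mathcal F_m$ is a set of $K$-tuples $f=(f_1,\dots,f_K)$ of positive probability densities with respect to $\lambda$; $\Theta_m=\mathbb S_{K-1}\times\mathcal F_m$, where $\mathbb S_{K-1}$ is the probability simplex. Put $$\gamma_n(\pi,f)=\sum_{l=1}^L-\log\Big(\sum_{k=1}^K\pi_k\prod_{i=1}^{n_l}f_k(X_l^i)\Big),\qquad \mathbf{KL}(s,t)=\int s\log\frac{s}{t}\,d\lambda .$$ For an assignment $k=(k_1,\dots,k_L)\in\{1,\dots,K\}^L$ put $\mathbf a_k(f,g)=\frac1n\sum_l n_l E_{s_l}\big[|\log(f_{k_l}/g_{k_l})|^2\big]$. A bracket $[f^-,f^+]$ is a pair of $K$-tuples of positive measurable functions with $f_j^-\le f_j^+$ for all $j$; it contains $f$ if $f_j^-\le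 f_j\le f_j^+$ for all $j$. Let $H_k(\delta,\mathcal G)$ be the logarithm of the least number of brackets with $\mathbf a_k(f^-,f^+)\le\delta^2$ such that every element of $\mathcal G$ lies in one of them ($+\infty$ if there is no finite such family), and let $\mathcal F_m^k(g,\sigma)=\{f\in\mathcal F_m:\mathbf a_k(g,f)\le\sigma^2\}$. **Assumptions.** 1. (Lower bound) For a real number $\tau$: $e^{-\tau}\le f_k/f'_k\le e^{\tau}$ for all $f,f'\in\mathcal F_m$ and all $k$, and $e^{-\tau}s_l\le f_k$ for all $f\in\mathcal F_m$ and all $k,l$. 2. (Entropy integral) $\phi_m:[0,\infty)\to[0,\infty)$ is non-decreasing, $\delta\mapsto\phi_m(\delta)/\delta$ is non-increasing on $(0,\infty)$, and $\int_0^\sigma H_k(\delta,\mathcal F_m^k(f,\sigma))^{1/2}\,d\delta\le\phi_m(\sigma)$ for all $\sigma\ge0$, all $f\in\mathcal F_m$ and all assignments $k$. 3. (Separability) There are a countable $\mathcal F_m'\subset\mathcal F_m$ and a set $\mathcal X'\subset\mathcal X$ with $\lambda(\mathcal X\setminus\mathcal X')=0$ such that for every $f\in\mathcal F_m$ some sequence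 $(f^{(j)})$ in $\mathcal F_m'$ satisfies $\log f^{(j)}_k(x)\to\log f_k(x)$ for all $k$ and all $x\in\mathcal X'$. **Theorem.** For every $C_1>1$ there is a constant $C_2>0$ depending only on $C_1$, and for every real $\tau$ a constant $\kappa_0>0$ depending only on $C_1$ and $\tau$, such that the following holds in every setting as above that satisfies Assumptions 1, 2 and 3 with this $\tau$. Let $\sigma_m>0$ be the root of $\phi_m(\sigma)/\sigma=\sqrt n\,\sigma$ and $\mathfrak D_m=n\sigma_m^2$. Let $\eta\ge0$, let $(\widehat\pi,\widehat f)\in\Theta_m$ be an $\eta$-log-likelihood minimizer, $\gamma_n(\widehat\pi,\widehat f)\le\inf_{(\pi,f)\in\Theta_m}\gamma_n(\pi,f)+\eta$, and let $\widehat k_l\in\arg\max_{k}\widehat\pi_k\prod_{i=1}^{n_l}\widehat f_k(X_l^i)$ for every $l$. Then $$E\Big[\sum_{l=1}^L\frac{n_l}{n}\mathbf{KL}(s_l,\widehat f_{\widehat k_l})\Big]\le C_1\Big\{\inf_{f\in\mathcal F_m,\,(k_l)\in\{1,\dots,K\}^L}\sum_{l=1}^L\frac{n_l}{n}\mathbf{KL}(s_l,f_{k_l})+\frac{(2+\kappa_0)L\log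 K+\kappa_0\mathfrak D_m}{n}+\frac{\eta}{n}\Big\}+\frac{C_2}{n}.$$ -/

import Mathlib

open MeasureTheory ProbabilityTheory
open scoped ENNReal

namespace MixtureRisk

noncomputable section

/-- A probability density with respect to `lam`. -/
structure IsDensity {𝒳 : Type*} [MeasurableSpace 𝒳] (lam : Measure 𝒳) (f : 𝒳 → ℝ) : Prop where
  measurable : Measurable f
  nonneg : ∀ x, 0 ≤ f x
  lintegral_eq_one : ∫⁻ x, ENNReal.ofReal (f x) ∂lam = 1

/-- The measure `f dlam`. -/
def law {𝒳 : Type*} [MeasurableSpace 𝒳] (lam : Measure 𝒳) (f : 𝒳 → ℝ) : Measure 𝒳 :=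
  lam.withDensity fun x => ENNReal.ofReal (f x)

/-- The total number of observations `n = ∑ n_l`. -/
def total {L : ℕ} (N : Fin L → ℕ) : ℕ := ∑ l, N l

/-- A model: a set of `K`-tuples of everywhere positive probability densities. -/
def IsModel {𝒳 : Type*} [MeasurableSpace 𝒳] (lam : Measure 𝒳) {K : ℕ}
    (F : Set (Fin K → 𝒳 → ℝ)) : Prop :=
  ∀ f ∈ F, ∀ k, IsDensity lam (f k) ∧ ∀ x, 0 < f k x

/-- Lower bound assumption: `e^{-τ} ≤ f / f' ≤ e^τ` for `f, f'` in the model (component by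
component), and `e^{-τ} ≤ f / s_l` for every `l`, with denominators cleared. -/
def RatioBound {𝒳 : Type*} {K L : ℕ} (F : Set (Fin K → 𝒳 → ℝ)) (s : Fin L → 𝒳 → ℝ)
    (τ : ℝ) : Prop :=
  (∀ f ∈ F, ∀ f' ∈ F, ∀ k x,
    Real.exp (-τ) * f' k x ≤ f k x ∧ f k x ≤ Real.exp τ * f' k x) ∧
  (∀ f ∈ F, ∀ k l x, Real.exp (-τ) * s l x ≤ f k x)

/-- `a(f, g) = (1/n) ∑_l n_l E_{s_l} |log (f_{k_l} / g_{k_l})|^2` for the assignment `k`. -/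
def aDiv {𝒳 : Type*} [MeasurableSpace 𝒳] (lam : Measure 𝒳) {K L : ℕ} (N : Fin L → ℕ)
    (s : Fin L → 𝒳 → ℝ) (k : Fin L → Fin K) (f g : Fin K → 𝒳 → ℝ) : ℝ≥0∞ :=
  ∑ l, (N l : ℝ≥0∞) / (total N : ℝ≥0∞) *
    ∫⁻ x, ENNReal.ofReal (|Real.log (f (k l) x / g (k l) x)| ^ 2) ∂(law lam (s l))

/-- A `K`-tuple of brackets `[fm_j, fp_j]` of positive measurable functions. -/
def IsBracket {𝒳 : Type*} [MeasurableSpace 𝒳] {K : ℕ} (fm fp : Fin K → 𝒳 → ℝ) : Prop :=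
  ∀ j, Measurable (fm j) ∧ Measurable (fp j) ∧ ∀ x, 0 < fm j x ∧ fm j x ≤ fp j x

/-- `G` is covered by `M` brackets `[fm, fp]` of size at most `δ`, i.e. `a(fm, fp) ≤ δ^2`. -/
def BracketCover {𝒳 : Type*} [MeasurableSpace 𝒳] (lam : Measure 𝒳) {K L : ℕ} (N : Fin L → ℕ)
    (s : Fin L → 𝒳 → ℝ) (k : Fin L → Fin K) (δ : ℝ) (G : Set (Fin K → 𝒳 → ℝ)) (M : ℕ) : Prop :=
  ∃ fm fp : Fin M → Fin K → 𝒳 → ℝ,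
    (∀ i, IsBracket (fm i) (fp i) ∧ aDiv lam N s k (fm i) (fp i) ≤ ENNReal.ofReal (δ ^ 2)) ∧
    ∀ f ∈ G, ∃ i, ∀ j x, fm i j x ≤ f j x ∧ f j x ≤ fp i j x

/-- Bracketing entropy: the logarithm of the least number of brackets of size at most `δ`
that cover `G`, equal to `∞` if no finite number suffices. -/
def bracketEntropy {𝒳 : Type*} [MeasurableSpace 𝒳] (lam : Measure 𝒳) {K L : ℕ} (N : Fin L → ℕ)
    (s : Fin L → 𝒳 → ℝ) (k : Fin L → Fin K) (δ : ℝ) (G : Set (Fin K → 𝒳 → ℝ)) : ℝ≥0∞ :=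
  ⨅ (M : ℕ) (_ : BracketCover lam N s k δ G M), ENNReal.ofReal (Real.log M)

/-- The localized model `F(g, σ) = {f ∈ F | a(g, f) ≤ σ^2}`. -/
def localized {𝒳 : Type*} [MeasurableSpace 𝒳] (lam : Measure 𝒳) {K L : ℕ} (N : Fin L → ℕ)
    (s : Fin L → 𝒳 → ℝ) (k : Fin L → Fin K) (F : Set (Fin K → 𝒳 → ℝ))
    (g : Fin K → 𝒳 → ℝ) (σ : ℝ) : Set (Fin K → 𝒳 → ℝ) :=
  {f | f ∈ F ∧ aDiv lam N s k g f ≤ ENNReal.ofReal (σ ^ 2)}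

/-- Entropy integral assumption, with one `φ` for all cluster assignments. -/
structure EntropyIntegralBound {𝒳 : Type*} [MeasurableSpace 𝒳] (lam : Measure 𝒳) {K L : ℕ}
    (N : Fin L → ℕ) (s : Fin L → 𝒳 → ℝ) (F : Set (Fin K → 𝒳 → ℝ)) (φ : ℝ → ℝ) : Prop where
  nonneg : ∀ σ, 0 ≤ σ → 0 ≤ φ σ
  mono : MonotoneOn φ (Set.Ici 0)
  anti : AntitoneOn (fun δ => φ δ / δ) (Set.Ioi 0)
  integral_le : ∀ σ, 0 ≤ σ → ∀ k : Fin L → Fin K, ∀ f ∈ F,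
    ∫⁻ δ in Set.Ioc 0 σ, bracketEntropy lam N s k δ (localized lam N s k F f σ) ^ (1 / 2 : ℝ)
      ≤ ENNReal.ofReal (φ σ)

/-- Separability assumption. -/
def Separable {𝒳 : Type*} [MeasurableSpace 𝒳] (lam : Measure 𝒳) {K : ℕ}
    (F : Set (Fin K → 𝒳 → ℝ)) : Prop :=
  ∃ F' : Set (Fin K → 𝒳 → ℝ), F' ⊆ F ∧ F'.Countable ∧
    ∃ X' : Set 𝒳, lam X'ᶜ = 0 ∧
      ∀ f ∈ F, ∃ g : ℕ → Fin K → 𝒳 → ℝ, (∀ j, g j ∈ F') ∧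
        ∀ x ∈ X', ∀ k, Filter.Tendsto (fun j => Real.log (g j k x)) Filter.atTop
          (nhds (Real.log (f k x)))

/-- The empirical contrast `γ_n(π, f) = ∑_l -log (∑_k π_k ∏_i f_k(x_l^i))`. -/
def contrast {𝒳 : Type*} {K L : ℕ} {N : Fin L → ℕ} (x : (l : Fin L) → Fin (N l) → 𝒳)
    (p : Fin K → ℝ) (f : Fin K → 𝒳 → ℝ) : ℝ :=
  ∑ l, -Real.log (∑ k, p k * ∏ i, f k (x l i))

/-- `(p, f) ∈ Θ = simplex × F` minimizes the contrast over `Θ` up to `η`. -/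
def IsEtaMinimizer {𝒳 : Type*} {K L : ℕ} {N : Fin L → ℕ} (x : (l : Fin L) → Fin (N l) → 𝒳)
    (F : Set (Fin K → 𝒳 → ℝ)) (η : ℝ) (p : Fin K → ℝ) (f : Fin K → 𝒳 → ℝ) : Prop :=
  p ∈ stdSimplex ℝ (Fin K) ∧ f ∈ F ∧
    ∀ q ∈ stdSimplex ℝ (Fin K), ∀ g ∈ F, contrast x p f ≤ contrast x q g + η

/-- `k` is a maximum a posteriori assignment for the parameters `(p, f)`. -/
def IsMAP {𝒳 : Type*} {K L : ℕ} {N : Fin L → ℕ} (x : (l : Fin L) → Fin (N l) → 𝒳)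
    (p : Fin K → ℝ) (f : Fin K → 𝒳 → ℝ) (k : Fin L → Fin K) : Prop :=
  ∀ l j, p j * ∏ i, f j (x l i) ≤ p (k l) * ∏ i, f (k l) (x l i)

/-- The weighted Kullback-Leibler loss `∑_l (n_l / n) KL(s_l, f_{k_l})`. -/
def weightedKL {𝒳 : Type*} [MeasurableSpace 𝒳] (lam : Measure 𝒳) {K L : ℕ} (N : Fin L → ℕ)
    (s : Fin L → 𝒳 → ℝ) (f : Fin K → 𝒳 → ℝ) (k : Fin L → Fin K) : ℝ≥0∞ :=
  ∑ l, (N l : ℝ≥0∞) / (total N : ℝ≥0∞) *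
    InformationTheory.klDiv (law lam (s l)) (law lam (f (k l)))

end

end MixtureRisk

open MeasureTheory ProbabilityTheory
open scoped ENNReal

namespace MixtureRisk

/-! ### Elementary exponential inequalities -/

/-! A maximum a posteriori assignment turns the mixture likelihood into a classification likelihood.
A mixture sum is at most `K` times its largest term, and with uniform weights it is at least `1/K`
times any term, so `(fHat, kHat)` almost maximizes the plain log-likelihood over densities and
assignments, up to `2 L log K + η` (`sum_log_le_of_isEtaMinimizer`). Its Kullback-Leibler loss is
therefore at most that of a competitor, plus the centered log-likelihood at `(fHat, kHat)`, minus a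
mean-zero term, plus this slack (`Setting.klSum_le_of_isEtaMinimizer`).

The centered term is split at an anchor `f₀ k`, a near minimizer of the loss in the model for each
assignment `k`. At the anchors there are only `K ^ L` variables. The ratio log(f/s) is bounded below
by `-τ` and its exponential has mean at most one, so its second and exponential moments are
controlled by its Kullback-Leibler divergence (`logRatio_moments`); a union bound costs `L log K`
(`Setting.exists_assignment_bound`). The ratios log(f/f₀) are bounded by `τ` and their L² size is
controlled by the losses, so they are handled by bracketing chaining on L² balls and peeling over
dyadic radii (`exists_ball_bound`, `Setting.exists_peeling_bound`).

Only upper bounds are needed, so the chaining follows decreasing upper functions. Their increments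
are nonpositive, and exp y ≤ 1 + y + y²/2 for y ≤ 0 gives sub-Gaussian upper bounds with no sup-norm
control of the brackets. Deviations are carried by integrable remainders `W`, valid at every sample
point for all functions at once, so no supremum has to be measured.

Since `C₂` may not depend on `τ`, two regimes are needed. With `D = n σ²`, if `D + L log K ≥ 1/32`
every constant depending on `τ` is absorbed in a multiple of `D + L log K`. Otherwise `K = 1`, and
the entropy bound forces the whole model into one ball covered by a single bracket, where a
universal bound holds (`Setting.exists_small_bound`). -/

theorem exp_le_of_nonpos {y : ℝ} (hy : y ≤ 0) : Real.exp y ≤ 1 + y + y ^ 2 / 2 := by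
  have h := Real.quadratic_le_exp_of_nonneg (x := -y) (by linarith)
  have h1 : Real.exp y * Real.exp (-y) = 1 := by rw [← Real.exp_add]; simp
  have h2 : 0 < Real.exp y := Real.exp_pos y
  have h3 : Real.exp y * (1 - y + y ^ 2 / 2) ≤ 1 := by
    rw [← h1]; exact mul_le_mul_of_nonneg_left (by linarith) h2.le
  have h4 : 0 < 1 - y + y ^ 2 / 2 := by nlinarith
  by_contra hc
  push Not at hc
  -- (1 + y + y²/2)(1 - y + y²/2) = 1 + y⁴/4 ≥ 1.
  nlinarith [mul_lt_mul_of_pos_right hc h4, sq_nonneg (y ^ 2)]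

theorem exp_le_of_le {z τ : ℝ} (hτ : 0 ≤ τ) (hz : z ≤ τ) :
    Real.exp z ≤ 1 + z + z ^ 2 * Real.exp τ := by
  have h1 : 1 ≤ Real.exp τ := Real.one_le_exp hτ
  rcases le_total z 0 with h | h
  · have := exp_le_of_nonpos h
    nlinarith [sq_nonneg z]
  · have h2 : Real.exp z ≤ Real.exp τ := Real.exp_le_exp.2 hz
    have h3 : 1 - z ≤ Real.exp (-z) := by have := Real.add_one_le_exp (-z); linarith
    have h4 : Real.exp z * Real.exp (-z) = 1 := by rw [← Real.exp_add]; simp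
    have h5 : Real.exp z * (1 - z) ≤ 1 := by
      exact (mul_le_mul_of_nonneg_left h3 (Real.exp_pos z).le).trans h4.le
    nlinarith [mul_le_mul_of_nonneg_left h5 (by linarith : (0:ℝ) ≤ 1 + z),
      mul_le_mul_of_nonneg_left h2 (sq_nonneg z)]

/-- The gap exp u - 1 - u is quadratic near zero but only linear towards -∞; the floor `-τ` on `u`
buys the comparison at the price of exp τ. -/
theorem sq_le_exp_sub {u τ : ℝ} (hτ : 0 ≤ τ) (hu : -τ ≤ u) :
    u ^ 2 ≤ 4 * Real.exp τ * (Real.exp u - 1 - u) := by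
  have h1 : 1 ≤ Real.exp τ := Real.one_le_exp hτ
  rcases le_total 0 u with h | h
  · have := Real.quadratic_le_exp_of_nonneg h
    nlinarith [sq_nonneg u]
  · obtain ⟨t, rfl⟩ : ∃ t, u = -t := ⟨-u, by ring⟩
    have ht : 0 ≤ t := by linarith
    have h2 : Real.exp t ≤ Real.exp τ := Real.exp_le_exp.2 (by linarith)
    have h4 : Real.exp t * Real.exp (-t) = 1 := by rw [← Real.exp_add]; simp
    have h0 := Real.exp_pos t
    -- The factor exp(-t) has been taken out of the gap. For t ≤ 1, exp t · (1 - t/2)² ≤ 1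
    -- rearranges to exp t · t²/4 ≤ 1 - exp t + t exp t.
    have key : t ^ 2 ≤ 4 * (1 - Real.exp t + t * Real.exp t) := by
      rcases le_total 1 t with h5 | h5
      · have := Real.quadratic_le_exp_of_nonneg ht
        nlinarith [mul_le_mul_of_nonneg_left this (by linarith : (0:ℝ) ≤ t - 1), pow_nonneg ht 3]
      · have h6 : 1 - t / 2 ≤ Real.exp (-(t / 2)) := by
          have := Real.add_one_le_exp (-(t / 2)); linarith
        have h7 : (1 - t / 2) ^ 2 ≤ Real.exp (-t) := by
          have : Real.exp (-t) = Real.exp (-(t / 2)) ^ 2 := by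
            rw [← Real.exp_nat_mul]; congr 1; push_cast; ring
          rw [this]; exact pow_le_pow_left₀ (by linarith) h6 2
        have h8 : Real.exp t * (1 - t / 2) ^ 2 ≤ 1 := by
          exact (mul_le_mul_of_nonneg_left h7 h0.le).trans h4.le
        have h9 : 1 ≤ Real.exp t := Real.one_le_exp ht
        nlinarith [mul_nonneg (sq_nonneg t) (sub_nonneg.2 h9)]
    have h10 : Real.exp (-t) - 1 - -t = Real.exp (-t) * (1 - Real.exp t + t * Real.exp t) := by
      linear_combination (1 - t) * h4
    have h11 : 1 ≤ Real.exp τ * Real.exp (-t) := by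
      rw [← h4]; exact mul_le_mul_of_nonneg_right h2 (Real.exp_pos _).le
    rw [h10]
    have h12 : 0 ≤ 1 - Real.exp t + t * Real.exp t := by nlinarith [sq_nonneg t]
    nlinarith [mul_le_mul_of_nonneg_right h11 h12]

theorem exp_mul_le_exp_sub {u τ lm : ℝ} (hτ : 0 ≤ τ) (hu : -τ ≤ u) (h0 : 0 ≤ lm) (h1 : lm ≤ 1) :
    Real.exp (lm * u) ≤ 1 + lm * u + 2 * lm ^ 2 * Real.exp τ * (Real.exp u - 1 - u) := by
  have hτ1 : 1 ≤ Real.exp τ := Real.one_le_exp hτ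
  have hE : 0 ≤ Real.exp u - 1 - u := by have := Real.add_one_le_exp u; linarith
  rcases le_total 0 u with h | h
  · have hmono : MonotoneOn (fun x => lm ^ 2 * (Real.exp x - 1 - x) -
        (Real.exp (lm * x) - 1 - lm * x)) (Set.Ici 0) := by
      apply monotoneOn_of_deriv_nonneg (convex_Ici 0)
      · fun_prop
      · fun_prop
      · intro x _
        have hd : HasDerivAt (fun x => lm ^ 2 * (Real.exp x - 1 - x) -
            (Real.exp (lm * x) - 1 - lm * x))
            (lm ^ 2 * (Real.exp x - 1) - (Real.exp (lm * x) * (lm * 1) - lm * 1)) x := by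
          have hA := (((Real.hasDerivAt_exp x).sub_const 1).sub (hasDerivAt_id x)).const_mul (lm ^ 2)
          have hB := ((((hasDerivAt_id x).const_mul lm).exp).sub_const 1).sub
            ((hasDerivAt_id x).const_mul lm)
          exact hA.sub hB
        rw [hd.deriv]
        -- Convexity between 0 and x gives exp(lm x) ≤ lm exp x + 1 - lm, which is the sign of the
        -- derivative after multiplying by `lm`.
        have hc := convexOn_exp.2 (Set.mem_univ x) (Set.mem_univ 0) h0
          (by linarith : 0 ≤ 1 - lm) (by ring)
        simp only [smul_eq_mul, mul_zero, add_zero, Real.exp_zero, mul_one] at hc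
        nlinarith [mul_le_mul_of_nonneg_left hc h0]
    have := hmono (Set.self_mem_Ici) (Set.mem_Ici.2 h) h
    simp only [Real.exp_zero, mul_zero, sub_self] at this
    nlinarith [mul_nonneg (sq_nonneg lm) hE, mul_le_mul_of_nonneg_right hτ1
      (mul_nonneg (sq_nonneg lm) hE)]
  · have h2 := exp_le_of_nonpos (mul_nonpos_of_nonneg_of_nonpos h0 h)
    have h3 := sq_le_exp_sub hτ hu
    nlinarith [mul_le_mul_of_nonneg_left h3 (sq_nonneg lm)]

/-- Converts an exponential moment directly into a bound on an expected excess, so that no tail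
probability has to be integrated. -/
theorem max_zero_le_exp_div {lm y : ℝ} (hl : 0 < lm) : max 0 y ≤ Real.exp (lm * y) / lm := by
  have h := Real.add_one_le_exp (lm * y)
  rw [le_div_iff₀ hl]
  rcases max_cases 0 y with ⟨h1, _⟩ | ⟨h1, _⟩ <;> rw [h1]
  · simpa using (Real.exp_pos _).le
  · nlinarith

/-! ### Centered sums of independent variables -/

section Centered

variable {Ω 𝒳 Q : Type*} [MeasurableSpace Ω] [Fintype Q]

/-- The centered sum `∑ q, (g q (X q) - E[g q (X q)])`. -/
noncomputable def centeredSum (P : Measure Ω) (X : Q → Ω → 𝒳) (g : Q → 𝒳 → ℝ) (ω : Ω) : ℝ :=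
  ∑ q, (g q (X q ω) - ∫ ω', g q (X q ω') ∂P)

variable {P : Measure Ω} {X : Q → Ω → 𝒳}

theorem integrable_centeredSum [IsFiniteMeasure P] {g : Q → 𝒳 → ℝ}
    (hg : ∀ q, Integrable (fun ω => g q (X q ω)) P) : Integrable (centeredSum P X g) P := by
  unfold centeredSum
  exact integrable_finsetSum _ fun q _ => (hg q).sub (integrable_const _)

theorem integral_centeredSum [IsProbabilityMeasure P] {g : Q → 𝒳 → ℝ}
    (hg : ∀ q, Integrable (fun ω => g q (X q ω)) P) : ∫ ω, centeredSum P X g ω ∂P = 0 := by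
  unfold centeredSum
  rw [integral_finsetSum (f := fun q ω => g q (X q ω) - ∫ ω', g q (X q ω') ∂P) _
    fun q _ => (hg q).sub (integrable_const _)]
  refine Finset.sum_eq_zero fun q _ => ?_
  rw [integral_sub (hg q) (integrable_const _)]
  simp

theorem centeredSum_add {g h : Q → 𝒳 → ℝ} (hg : ∀ q, Integrable (fun ω => g q (X q ω)) P)
    (hh : ∀ q, Integrable (fun ω => h q (X q ω)) P) (ω : Ω) :
    centeredSum P X (fun q x => g q x + h q x) ω = centeredSum P X g ω + centeredSum P X h ω := by
  unfold centeredSum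
  rw [← Finset.sum_add_distrib]
  refine Finset.sum_congr rfl fun q _ => ?_
  rw [integral_add (hg q) (hh q)]
  ring

theorem integral_one_add_mul_add_mul [IsProbabilityMeasure P] {f g : Ω → ℝ}
    (hf : Integrable f P) (hg : Integrable g P) (a b : ℝ) :
    Integrable (fun ω => 1 + a * f ω + b * g ω) P ∧
      ∫ ω, (1 + a * f ω + b * g ω) ∂P = 1 + a * ∫ ω, f ω ∂P + b * ∫ ω, g ω ∂P := by
  have h1 : Integrable (fun ω => 1 + a * f ω) P := (integrable_const 1).add (hf.const_mul a)
  refine ⟨h1.add (hg.const_mul b), ?_⟩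
  rw [integral_add h1 (hg.const_mul b), integral_add (integrable_const 1) (hf.const_mul a),
    integral_const_mul, integral_const_mul]
  simp

/-- Exponential moments of centered sums: the bounds on the summands multiply. -/
theorem integral_exp_centeredSum_le [MeasurableSpace 𝒳] [IsProbabilityMeasure P]
    (hX : ∀ q, AEMeasurable (X q) P) (hind : iIndepFun X P)
    {g : Q → 𝒳 → ℝ} (hg : ∀ q, Measurable (g q)) {lm : ℝ} {V : Q → ℝ}
    (he : ∀ q, Integrable (fun ω => Real.exp (lm * g q (X q ω))) P)
    (hV : ∀ q, ∫ ω, Real.exp (lm * g q (X q ω)) ∂P ≤ 1 + lm * ∫ ω, g q (X q ω) ∂P + V q) :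
    Integrable (fun ω => Real.exp (lm * centeredSum P X g ω)) P ∧
      ∫ ω, Real.exp (lm * centeredSum P X g ω) ∂P ≤ Real.exp (∑ q, V q) := by
  have hcomp : iIndepFun (fun q => g q ∘ X q) P := hind.comp g hg
  have hmgf := hcomp.mgf_sum₀ (t := lm) (fun q => (hg q).comp_aemeasurable (hX q)) Finset.univ
  have hsum : ∫ ω, Real.exp (lm * ∑ q, g q (X q ω)) ∂P =
      ∏ q, ∫ ω, Real.exp (lm * g q (X q ω)) ∂P := by
    simpa [mgf, Finset.sum_apply] using hmgf
  have hpos : ∀ q, 0 < ∫ ω, Real.exp (lm * g q (X q ω)) ∂P := fun q =>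
    integral_exp_pos (he q)
  have hint : Integrable (fun ω => Real.exp (lm * ∑ q, g q (X q ω))) P := by
    -- A non-integrable function has Bochner integral zero, whereas the product of the individual
    -- exponential moments is positive.
    by_contra hc
    rw [integral_undef hc] at hsum
    exact (Finset.prod_pos fun q _ => hpos q).ne hsum
  have heq : ∀ ω, Real.exp (lm * centeredSum P X g ω) =
      Real.exp (-(lm * ∑ q, ∫ ω', g q (X q ω') ∂P)) * Real.exp (lm * ∑ q, g q (X q ω)) := by
    intro ω
    rw [← Real.exp_add, centeredSum, Finset.sum_sub_distrib]
    congr 1; ring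
  simp_rw [heq]
  refine ⟨hint.const_mul _, ?_⟩
  rw [integral_const_mul, hsum]
  calc _ ≤ Real.exp (-(lm * ∑ q, ∫ ω', g q (X q ω') ∂P)) *
        ∏ q, Real.exp (lm * ∫ ω, g q (X q ω) ∂P + V q) := by
        refine mul_le_mul_of_nonneg_left ?_ (Real.exp_pos _).le
        refine Finset.prod_le_prod (fun q _ => (hpos q).le) fun q _ => ?_
        have := Real.add_one_le_exp (lm * ∫ ω, g q (X q ω) ∂P + V q)
        linarith [hV q]
    _ = Real.exp (∑ q, V q) := by
        rw [← Real.exp_sum, ← Real.exp_add, Finset.sum_add_distrib, ← Finset.mul_sum]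
        congr 1; ring

/-- A finite family with a common exponential moment bound stays below a level up to a
nonnegative remainder of small expectation. -/
theorem exists_remainder [IsFiniteMeasure P] {ι : Type*} [Fintype ι] {Y : ι → Ω → ℝ} {lm b E₀ : ℝ} (hl : 0 < lm)
    (hY : ∀ i, Integrable (Y i) P) (he : ∀ i, Integrable (fun ω => Real.exp (lm * Y i ω)) P)
    (hE : ∀ i, ∫ ω, Real.exp (lm * Y i ω) ∂P ≤ E₀) :
    ∃ W : Ω → ℝ, (∀ ω, 0 ≤ W ω) ∧ Integrable W P ∧
      ∫ ω, W ω ∂P ≤ Fintype.card ι * E₀ * Real.exp (-(lm * b)) / lm ∧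
      ∀ i ω, Y i ω ≤ b + W ω := by
  have hint : ∀ i, Integrable (fun ω => max 0 (Y i ω - b)) P := fun i =>
    ((integrable_const 0).sup ((hY i).sub (integrable_const b)))
  refine ⟨fun ω => ∑ i, max 0 (Y i ω - b), fun ω => Finset.sum_nonneg fun i _ => le_max_left _ _,
    integrable_finsetSum _ fun i _ => hint i, ?_, ?_⟩
  · rw [integral_finsetSum _ fun i _ => hint i]
    calc _ ≤ ∑ _i : ι, E₀ * Real.exp (-(lm * b)) / lm := by
          refine Finset.sum_le_sum fun i _ => ?_
          have heq : ∀ ω, Real.exp (lm * (Y i ω - b)) / lm =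
              (Real.exp (-(lm * b)) / lm) * Real.exp (lm * Y i ω) := by
            intro ω
            rw [div_mul_eq_mul_div, ← Real.exp_add]
            congr 2; ring
          calc ∫ ω, max 0 (Y i ω - b) ∂P
              ≤ ∫ ω, (Real.exp (-(lm * b)) / lm) * Real.exp (lm * Y i ω) ∂P := by
                refine integral_mono (hint i) ((he i).const_mul _) fun ω => ?_
                rw [← heq]; exact max_zero_le_exp_div hl
            _ ≤ (Real.exp (-(lm * b)) / lm) * E₀ := by
                rw [integral_const_mul]
                exact mul_le_mul_of_nonneg_left (hE i) (by positivity)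
            _ = _ := by ring
      _ = _ := by simp; ring
  · intro i ω
    have h1 : max 0 (Y i ω - b) ≤ ∑ i, max 0 (Y i ω - b) :=
      Finset.single_le_sum (f := fun i => max 0 (Y i ω - b)) (fun j _ => le_max_left _ _)
        (Finset.mem_univ i)
    have := le_max_right 0 (Y i ω - b)
    show Y i ω ≤ b + ∑ i, max 0 (Y i ω - b)
    linarith

end Centered

/-! ### One-sided bracketing chaining -/

section Chaining

variable {Ω 𝒳 Q : Type*} [MeasurableSpace Ω] [MeasurableSpace 𝒳] [Fintype Q]

/-- The squared `L²` size `∑ q, E[h q (X q)²]`. -/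
noncomputable def sqSize (P : Measure Ω) (X : Q → Ω → 𝒳) (h : Q → 𝒳 → ℝ) : ℝ≥0∞ :=
  ∑ q, ∫⁻ ω, ENNReal.ofReal ((h q (X q ω)) ^ 2) ∂P

/-- `𝒢` is covered by `M` brackets `[a, b]` of `L²` size at most `v`. -/
def SqCover (P : Measure Ω) (X : Q → Ω → 𝒳) (𝒢 : Set (Q → 𝒳 → ℝ)) (v : ℝ) (M : ℕ) : Prop :=
  ∃ a b : Fin M → Q → 𝒳 → ℝ,
    (∀ i q, Measurable (a i q) ∧ Measurable (b i q) ∧ ∀ x, a i q x ≤ b i q x) ∧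
    (∀ i, sqSize P X (fun q x => b i q x - a i q x) ≤ ENNReal.ofReal (v ^ 2)) ∧
    ∀ g ∈ 𝒢, ∃ i, ∀ q x, a i q x ≤ g q x ∧ g q x ≤ b i q x

/-- A finite family of integrable upper functions `u`, each with an error `D` of `L²` size at
most `v`. -/
structure UpperNet (P : Measure Ω) (X : Q → Ω → 𝒳) {ι : Type} (u D : ι → Q → 𝒳 → ℝ)
    (v : ℝ) : Prop where
  meas_u : ∀ i q, Measurable (u i q)
  meas_D : ∀ i q, Measurable (D i q)
  nonneg : ∀ i q x, 0 ≤ D i q x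
  sq_le : ∀ i, sqSize P X (D i) ≤ ENNReal.ofReal (v ^ 2)
  int_u : ∀ i q, Integrable (fun ω => u i q (X q ω)) P

/-- `u - D ≤ g ≤ u`. -/
def InCell (u D g : Q → 𝒳 → ℝ) : Prop := ∀ q x, g q x ≤ u q x ∧ u q x ≤ g q x + D q x

variable {P : Measure Ω} {X : Q → Ω → 𝒳}

theorem integrable_of_integrable_sq [IsFiniteMeasure P] {f : Ω → ℝ} (hf : AEStronglyMeasurable f P)
    (h : Integrable (fun ω => f ω ^ 2) P) : Integrable f P := by
  refine (h.add (integrable_const 1)).mono' hf (Filter.Eventually.of_forall fun ω => ?_)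
  simp only [Real.norm_eq_abs, Pi.add_apply]
  nlinarith [sq_abs (f ω), sq_nonneg (|f ω| - 1), abs_nonneg (f ω)]

theorem sqSize_le_iff (hX : ∀ q, AEMeasurable (X q) P) {h : Q → 𝒳 → ℝ}
    (hm : ∀ q, Measurable (h q)) {V : ℝ} (hV : 0 ≤ V) :
    sqSize P X h ≤ ENNReal.ofReal V ↔
      (∀ q, Integrable (fun ω => (h q (X q ω)) ^ 2) P) ∧
        ∑ q, ∫ ω, (h q (X q ω)) ^ 2 ∂P ≤ V := by
  have hmeas : ∀ q, AEStronglyMeasurable (fun ω => (h q (X q ω)) ^ 2) P := fun q =>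
    (((hm q).pow_const 2).comp_aemeasurable (hX q)).aestronglyMeasurable
  have key : (∀ q, Integrable (fun ω => (h q (X q ω)) ^ 2) P) →
      sqSize P X h = ENNReal.ofReal (∑ q, ∫ ω, (h q (X q ω)) ^ 2 ∂P) := by
    intro hi
    rw [ENNReal.ofReal_sum_of_nonneg fun q _ => integral_nonneg fun ω => sq_nonneg _]
    exact Finset.sum_congr rfl fun q _ =>
      (ofReal_integral_eq_lintegral_ofReal (hi q)
        (Filter.Eventually.of_forall fun ω => sq_nonneg _)).symm
  constructor
  · intro hle
    have hi : ∀ q, Integrable (fun ω => (h q (X q ω)) ^ 2) P := fun q => by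
      refine (lintegral_ofReal_ne_top_iff_integrable (hmeas q)
        (Filter.Eventually.of_forall fun ω => sq_nonneg _)).1 ?_
      refine ne_top_of_le_ne_top (ENNReal.ofReal_ne_top (r := V)) (le_trans ?_ hle)
      exact Finset.single_le_sum
        (f := fun q => ∫⁻ ω, ENNReal.ofReal ((h q (X q ω)) ^ 2) ∂P) (fun _ _ => zero_le)
        (Finset.mem_univ q)
    refine ⟨hi, ?_⟩
    rwa [key hi, ENNReal.ofReal_le_ofReal_iff hV] at hle
  · rintro ⟨hi, hle⟩
    rw [key hi]
    exact ENNReal.ofReal_le_ofReal hle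

variable [IsProbabilityMeasure P]

/-- Refining a net: the centered sum increases by at most `3/2 v θ` plus a small remainder,
because the increments are nonpositive. -/
theorem UpperNet.refine (hX : ∀ q, AEMeasurable (X q) P) (hind : iIndepFun X P)
    {𝒢 : Set (Q → 𝒳 → ℝ)} {ι : Type} [Fintype ι] {u D : ι → Q → 𝒳 → ℝ} {v v' θ c : ℝ} {M : ℕ}
    (hnet : UpperNet P X u D v) (hv : 0 < v) (hθ : 1 ≤ θ) (hcov : SqCover P X 𝒢 v' M)
    (hcard : (Fintype.card ι * M : ℝ) ≤ Real.exp (θ ^ 2 - c ^ 2)) :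
    ∃ (u' D' : ι × Fin M → Q → 𝒳 → ℝ) (W : Ω → ℝ), UpperNet P X u' D' v' ∧ (∀ ω, 0 ≤ W ω) ∧
      Integrable W P ∧ ∫ ω, W ω ∂P ≤ Real.exp (-c ^ 2) * v ∧
      ∀ i, ∀ g ∈ 𝒢, InCell (u i) (D i) g → ∃ j, InCell (u' j) (D' j) g ∧
        ∀ ω, centeredSum P X (u' j) ω ≤ centeredSum P X (u i) ω + 3 / 2 * v * θ + W ω := by
  obtain ⟨a, b, hab, hsz, hc⟩ := hcov
  -- The refined upper function is u + h = max(min(u, b), u - D). It still dominates every `g` of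
  -- the old cell that lies below `b`, and the clipping at `-D` bounds h² by D².
  let h : ι × Fin M → Q → 𝒳 → ℝ := fun p q x =>
    max (min 0 (b p.2 q x - u p.1 q x)) (-D p.1 q x)
  have hneg : ∀ p q x, h p q x ≤ 0 := fun p q x =>
    max_le (min_le_left _ _) (by linarith [hnet.nonneg p.1 q x])
  have hge : ∀ p q x, -D p.1 q x ≤ h p q x := fun p q x => le_max_right _ _
  have hmeas : ∀ p q, Measurable (h p q) := fun p q =>
    ((measurable_const.min ((hab p.2 q).2.1.sub (hnet.meas_u p.1 q)))).max (hnet.meas_D p.1 q).neg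
  have hDint := fun i => (sqSize_le_iff hX (hnet.meas_D i) (sq_nonneg v)).1 (hnet.sq_le i)
  have hsq : ∀ p q x, h p q x ^ 2 ≤ D p.1 q x ^ 2 := fun p q x => by
    nlinarith [hneg p q x, hge p q x]
  have hmX : ∀ p q, AEStronglyMeasurable (fun ω => h p q (X q ω)) P := fun p q =>
    ((hmeas p q).comp_aemeasurable (hX q)).aestronglyMeasurable
  have hsqi : ∀ p q, Integrable (fun ω => h p q (X q ω) ^ 2) P := fun p q =>
    ((hDint p.1).1 q).mono' (((hmeas p q).pow_const 2).comp_aemeasurable (hX q)).aestronglyMeasurable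
      (Filter.Eventually.of_forall fun ω => by
        rw [Real.norm_of_nonneg (sq_nonneg _)]; exact hsq p q _)
  have hint : ∀ p q, Integrable (fun ω => h p q (X q ω)) P := fun p q =>
    integrable_of_integrable_sq (hmX p q) (hsqi p q)
  have hθ0 : 0 < θ := by linarith
  -- With this `lm` the exponential moment is at most exp(θ²/2) and the level 3/2 v θ contributes
  -- exp(-3θ²/2). The cardinality exp(θ² - c²) then leaves exactly exp(-c²), times 1/lm = v/θ ≤ v.
  set lm : ℝ := θ / v with hlm
  have hl : 0 < lm := div_pos hθ0 hv
  have hlv : lm * v = θ := by rw [hlm]; field_simp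
  have hexpi : ∀ p q, Integrable (fun ω => Real.exp (lm * h p q (X q ω))) P := fun p q =>
    (integrable_const (1 : ℝ)).mono'
      (Real.measurable_exp.comp_aemeasurable
        (((hmeas p q).const_mul lm).comp_aemeasurable (hX q))).aestronglyMeasurable
      (Filter.Eventually.of_forall fun ω => by
        rw [Real.norm_of_nonneg (Real.exp_pos _).le]
        exact Real.exp_le_one_iff.2 (mul_nonpos_of_nonneg_of_nonpos hl.le (hneg p q _)))
  have hmgf : ∀ p, Integrable (fun ω => Real.exp (lm * centeredSum P X (h p) ω)) P ∧
      ∫ ω, Real.exp (lm * centeredSum P X (h p) ω) ∂P ≤ Real.exp (θ ^ 2 / 2) := fun p => by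
    have := integral_exp_centeredSum_le hX hind (hmeas p) (hexpi p)
      (V := fun q => lm ^ 2 / 2 * ∫ ω, D p.1 q (X q ω) ^ 2 ∂P) (fun q => by
        calc ∫ ω, Real.exp (lm * h p q (X q ω)) ∂P
            ≤ ∫ ω, ((1 + lm * h p q (X q ω)) + lm ^ 2 / 2 * D p.1 q (X q ω) ^ 2) ∂P := by
              refine integral_mono (hexpi p q)
                (integral_one_add_mul_add_mul (hint p q) ((hDint p.1).1 q) _ _).1 fun ω => ?_
              have h1 := exp_le_of_nonpos (mul_nonpos_of_nonneg_of_nonpos hl.le (hneg p q (X q ω)))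
              have h2 := mul_le_mul_of_nonneg_left (hsq p q (X q ω)) (sq_nonneg lm)
              show Real.exp (lm * h p q (X q ω)) ≤ _
              nlinarith
          _ = _ := (integral_one_add_mul_add_mul (hint p q) ((hDint p.1).1 q) _ _).2)
    refine ⟨this.1, this.2.trans (Real.exp_le_exp.2 ?_)⟩
    rw [← Finset.mul_sum]
    calc lm ^ 2 / 2 * ∑ q, ∫ ω, D p.1 q (X q ω) ^ 2 ∂P ≤ lm ^ 2 / 2 * v ^ 2 :=
          mul_le_mul_of_nonneg_left (hDint p.1).2 (by positivity)
      _ = θ ^ 2 / 2 := by rw [← hlv]; ring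
  obtain ⟨W, hW0, hWi, hWE, hWb⟩ := exists_remainder (b := 3 / 2 * v * θ) hl
    (fun p => integrable_centeredSum (hint p)) (fun p => (hmgf p).1) (fun p => (hmgf p).2)
  refine ⟨fun p q x => u p.1 q x + h p q x, fun p q x => b p.2 q x - a p.2 q x, W, ?_, hW0, hWi,
    hWE.trans ?_, ?_⟩
  · exact ⟨fun p q => (hnet.meas_u p.1 q).add (hmeas p q),
      fun p q => (hab p.2 q).2.1.sub (hab p.2 q).1,
      fun p q x => sub_nonneg.2 ((hab p.2 q).2.2 x), fun p => hsz p.2,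
      fun p q => (hnet.int_u p.1 q).add (hint p q)⟩
  · have e1 : lm * (3 / 2 * v * θ) = 3 / 2 * θ ^ 2 := by rw [← hlv]; ring
    rw [e1, Fintype.card_prod, Fintype.card_fin]
    push_cast
    rw [div_le_iff₀ hl]
    calc (Fintype.card ι * M : ℝ) * Real.exp (θ ^ 2 / 2) * Real.exp (-(3 / 2 * θ ^ 2))
        ≤ Real.exp (θ ^ 2 - c ^ 2) * Real.exp (θ ^ 2 / 2) * Real.exp (-(3 / 2 * θ ^ 2)) := by
          gcongr
      _ = Real.exp (-c ^ 2) * 1 := by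
          rw [← Real.exp_add, ← Real.exp_add, mul_one]; congr 1; ring
      _ ≤ Real.exp (-c ^ 2) * θ := mul_le_mul_of_nonneg_left hθ (Real.exp_pos _).le
      _ = Real.exp (-c ^ 2) * v * lm := by rw [← hlv]; ring
  · intro i g hg hcell
    obtain ⟨j, hj⟩ := hc g hg
    refine ⟨(i, j), ?_, ?_⟩
    · intro q x
      obtain ⟨h1, h2⟩ := hcell q x
      obtain ⟨h3, h4⟩ := hj q x
      simp only [h]
      constructor
      · have : g q x - u i q x ≤ min 0 (b j q x - u i q x) := le_min (by linarith) (by linarith)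
        linarith [le_max_left (min 0 (b j q x - u i q x)) (-D i q x)]
      · have : max (min 0 (b j q x - u i q x)) (-D i q x) ≤ b j q x - a j q x + g q x - u i q x :=
          max_le ((min_le_right _ _).trans (by linarith)) (by linarith [(hab j q).2.2 x])
        linarith
    · intro ω
      rw [centeredSum_add (hnet.int_u i) (hint (i, j))]
      linarith [hWb (i, j) ω]

/-- Stopping the chain costs only the sum of the expectations of the errors, each bounded through D
≤ D²/v + v. The factor depending on the sample size is harmless because `v` is taken very small. -/
theorem centeredSum_le_of_inCell (hX : ∀ q, AEMeasurable (X q) P) {ι : Type}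
    {u D : ι → Q → 𝒳 → ℝ} {v : ℝ} (hv : 0 < v)
    (hnet : UpperNet P X u D v) {g : Q → 𝒳 → ℝ} (hg : ∀ q, Integrable (fun ω => g q (X q ω)) P)
    {i : ι} (hcell : InCell (u i) (D i) g) (ω : Ω) :
    centeredSum P X g ω ≤ centeredSum P X (u i) ω + (1 + Fintype.card Q) * v := by
  have hD := (sqSize_le_iff hX (hnet.meas_D i) (sq_nonneg v)).1 (hnet.sq_le i)
  have hDi : ∀ q, Integrable (fun ω => D i q (X q ω)) P := fun q =>
    integrable_of_integrable_sq
      ((hnet.meas_D i q).comp_aemeasurable (hX q)).aestronglyMeasurable (hD.1 q)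
  have h1 : ∀ q, ∫ ω, D i q (X q ω) ∂P ≤ (∫ ω, D i q (X q ω) ^ 2 ∂P) / v + v := fun q => by
    calc ∫ ω, D i q (X q ω) ∂P ≤ ∫ ω, (D i q (X q ω) ^ 2 / v + v) ∂P := by
          refine integral_mono (hDi q) (((hD.1 q).div_const v).add (integrable_const v)) fun ω => ?_
          show D i q (X q ω) ≤ D i q (X q ω) ^ 2 / v + v
          rw [div_add' _ _ _ hv.ne', le_div_iff₀ hv]
          nlinarith [sq_nonneg (D i q (X q ω) - v), hnet.nonneg i q (X q ω)]
      _ = _ := by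
          rw [integral_add ((hD.1 q).div_const v) (integrable_const v), integral_div]
          simp
  have h2 : ∑ q, ∫ ω, D i q (X q ω) ∂P ≤ (1 + Fintype.card Q) * v := by
    calc _ ≤ ∑ q, ((∫ ω, D i q (X q ω) ^ 2 ∂P) / v + v) := Finset.sum_le_sum fun q _ => h1 q
      _ = (∑ q, ∫ ω, D i q (X q ω) ^ 2 ∂P) / v + Fintype.card Q * v := by
          rw [Finset.sum_add_distrib, Finset.sum_div]; simp
      _ ≤ v ^ 2 / v + Fintype.card Q * v := by
          gcongr; exact hD.2
      _ = _ := by field_simp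
  refine le_trans ?_ (add_le_add_right h2 _)
  unfold centeredSum
  rw [← Finset.sum_add_distrib]
  refine Finset.sum_le_sum fun q _ => ?_
  have h3 : ∫ ω, u i q (X q ω) ∂P ≤ ∫ ω, (g q (X q ω) + D i q (X q ω)) ∂P :=
    integral_mono (hnet.int_u i q) ((hg q).add (hDi q)) fun ω => (hcell q _).2
  rw [integral_add (hg q) (hDi q)] at h3
  linarith [(hcell q (X q ω)).1]

/-- Chaining below an initial net. -/
theorem exists_chain (hX : ∀ q, AEMeasurable (X q) P) (hind : iIndepFun X P)
    {𝒢 : Set (Q → 𝒳 → ℝ)} {ι : Type} [Fintype ι] {u D : ι → Q → 𝒳 → ℝ} {v c : ℝ}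
    (hnet : UpperNet P X u D v) (hv : 0 < v) (hc : 1 ≤ c) {M : ℕ → ℕ} {h : ℕ → ℝ}
    (hh : ∀ r, 0 ≤ h r) (hcard : (Fintype.card ι : ℝ) ≤ Real.exp (h 0 ^ 2))
    (hM : ∀ r, (M r : ℝ) ≤ Real.exp (h r ^ 2))
    (hcov : ∀ r, SqCover P X 𝒢 (v / 2 ^ r) (M r)) (R : ℕ) :
    ∃ (κ : Type) (_ : Fintype κ) (u' D' : κ → Q → 𝒳 → ℝ) (W : Ω → ℝ),
      UpperNet P X u' D' (v / 2 ^ R) ∧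
      (Fintype.card κ : ℝ) ≤ Real.exp ((c + ∑ s ∈ Finset.range (R + 1), h s) ^ 2 - c ^ 2) ∧
      (∀ ω, 0 ≤ W ω) ∧ Integrable W P ∧
      ∫ ω, W ω ∂P ≤ Real.exp (-c ^ 2) * (2 * v - 2 * (v / 2 ^ R)) ∧
      ∀ i, ∀ g ∈ 𝒢, InCell (u i) (D i) g → ∃ j, InCell (u' j) (D' j) g ∧
        ∀ ω, centeredSum P X (u' j) ω ≤ centeredSum P X (u i) ω +
          (3 * v * (c + h 0) + 6 * ∑ s ∈ Finset.range R, v / 2 ^ (s + 1) * h (s + 1)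
            - 3 * (v / 2 ^ R) * (c + ∑ s ∈ Finset.range (R + 1), h s)) + W ω := by
  induction R with
  | zero =>
    refine ⟨ι, inferInstance, u, D, fun _ => 0, by simpa using hnet, ?_, fun _ => le_rfl,
      integrable_zero _ _ _, by simp, fun i g _ hcell => ⟨i, hcell, fun ω => by simp⟩⟩
    refine hcard.trans (Real.exp_le_exp.2 ?_)
    simp only [zero_add, Finset.range_one, Finset.sum_singleton]
    nlinarith [hh 0]
  | succ R ih =>
    obtain ⟨κ, _, u₁, D₁, W₁, hnet₁, hcard₁, hW₁, hWi₁, hWE₁, hch₁⟩ := ih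
    set T := ∑ s ∈ Finset.range (R + 1), h s with hT
    have hT0 : 0 ≤ T := Finset.sum_nonneg fun s _ => hh s
    have hv' : 0 < v / 2 ^ R := by positivity
    have hcard₂ : (Fintype.card κ * M (R + 1) : ℝ) ≤
        Real.exp ((c + (T + h (R + 1))) ^ 2 - c ^ 2) := by
      calc (Fintype.card κ * M (R + 1) : ℝ)
          ≤ Real.exp ((c + T) ^ 2 - c ^ 2) * Real.exp (h (R + 1) ^ 2) := by
            gcongr; exact hM (R + 1)
        _ ≤ _ := by
            rw [← Real.exp_add]
            refine Real.exp_le_exp.2 ?_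
            nlinarith [mul_nonneg (by linarith : (0:ℝ) ≤ c + T) (hh (R + 1))]
    obtain ⟨u₂, D₂, W₂, hnet₂, hW₂, hWi₂, hWE₂, hch₂⟩ := hnet₁.refine hX hind hv'
      (by linarith [hh (R + 1)] : 1 ≤ c + (T + h (R + 1))) (hcov (R + 1)) hcard₂
    have hhalf : v / 2 ^ (R + 1) = v / 2 ^ R / 2 := by rw [pow_succ]; field_simp
    refine ⟨κ × Fin (M (R + 1)), inferInstance, u₂, D₂, fun ω => W₁ ω + W₂ ω, hnet₂, ?_,
      fun ω => add_nonneg (hW₁ ω) (hW₂ ω), hWi₁.add hWi₂, ?_, ?_⟩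
    · rw [Finset.sum_range_succ _ (R + 1), ← hT]
      simpa using hcard₂
    · rw [integral_add hWi₁ hWi₂, hhalf]
      nlinarith [hWE₁, hWE₂]
    · intro i g hg hcell
      obtain ⟨j, hj, hjb⟩ := hch₁ i g hg hcell
      obtain ⟨j', hj', hjb'⟩ := hch₂ j g hg hj
      refine ⟨j', hj', fun ω => ?_⟩
      have h1 := hjb ω
      have h2 := hjb' ω
      -- The negative term of the bound makes the induction exact: it grows by 3/2 · v/2^R · (c + h
      -- 0 + ... + h (R+1)), the cost of this refinement. This is summation by parts of the
      -- accumulated root entropies.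
      rw [Finset.sum_range_succ _ (R + 1), ← hT, Finset.sum_range_succ _ R, hhalf]
      nlinarith [h1, h2]

end Chaining

/-! ### Uniform bounds over an L² ball of bounded functions -/

section Ball

variable {Ω 𝒳 Q : Type*} [MeasurableSpace Ω] [MeasurableSpace 𝒳] [Fintype Q]
variable {P : Measure Ω} [IsProbabilityMeasure P] {X : Q → Ω → 𝒳}

theorem integrable_of_abs_le {f : Ω → ℝ} (hf : AEStronglyMeasurable f P) {B : ℝ}
    (h : ∀ ω, |f ω| ≤ B) : Integrable f P :=
  (integrable_const B).mono' hf (Filter.Eventually.of_forall h)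

theorem exists_initial_net (hX : ∀ q, AEMeasurable (X q) P) {𝒢 : Set (Q → 𝒳 → ℝ)} {v τ : ℝ}
    {M : ℕ} (hτ : 0 ≤ τ) (hgm : ∀ g ∈ 𝒢, ∀ q, Measurable (g q))
    (hgτ : ∀ g ∈ 𝒢, ∀ q x, |g q x| ≤ τ) (hgv : ∀ g ∈ 𝒢, sqSize P X g ≤ ENNReal.ofReal (v ^ 2))
    (hcov : SqCover P X 𝒢 v M) :
    ∃ u D : Fin M → Q → 𝒳 → ℝ, UpperNet P X u D v ∧ (∀ i q x, |u i q x| ≤ τ) ∧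
      (∀ i, sqSize P X (u i) ≤ ENNReal.ofReal (4 * v ^ 2)) ∧
      ∀ g ∈ 𝒢, ∃ i, InCell (u i) (D i) g := by
  classical
  obtain ⟨a, b, hab, hsz, hc⟩ := hcov
  let p : Fin M → Prop := fun i => ∃ g ∈ 𝒢, ∀ q x, a i q x ≤ g q x ∧ g q x ≤ b i q x
  -- Truncation to [-τ, τ] preserves domination of the class. A bracket containing no member gets
  -- zero; in any other, `u` lies between some `g` and g + (b - a), so its squared size is at most
  -- 2v² + 2v².
  let u : Fin M → Q → 𝒳 → ℝ := fun i q x => if p i then max (-τ) (min τ (b i q x)) else 0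
  have hum : ∀ i q, Measurable (u i q) := fun i q => by
    by_cases hp : p i
    · simp only [u, hp, if_true]
      exact measurable_const.max (measurable_const.min (hab i q).2.1)
    · simp only [u, hp, if_false]
      exact measurable_const
  have hcell : ∀ i, ∀ g ∈ 𝒢, (∀ q x, a i q x ≤ g q x ∧ g q x ≤ b i q x) →
      InCell (u i) (fun q x => b i q x - a i q x) g := fun i g hg h q x => by
    have hp : p i := ⟨g, hg, h⟩
    obtain ⟨h1, h2⟩ := abs_le.1 (hgτ g hg q x)
    obtain ⟨h3, h4⟩ := h q x
    simp only [u, hp, if_true]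
    exact ⟨le_max_of_le_right (le_min h2 h4),
      max_le (by linarith) ((min_le_right _ _).trans (by linarith))⟩
  have huτ : ∀ i q x, |u i q x| ≤ τ := fun i q x => by
    by_cases hp : p i
    · simp only [u, hp, if_true]
      exact abs_le.2 ⟨le_max_left _ _, max_le (by linarith) (min_le_left _ _)⟩
    · simpa [u, hp] using hτ
  refine ⟨u, fun i q x => b i q x - a i q x, ⟨hum, fun i q => (hab i q).2.1.sub (hab i q).1,
    fun i q x => sub_nonneg.2 ((hab i q).2.2 x), hsz, fun i q => ?_⟩, huτ, fun i => ?_,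
    fun g hg => ?_⟩
  · exact integrable_of_abs_le ((hum i q).comp_aemeasurable (hX q)).aestronglyMeasurable
      fun ω => huτ i q _
  · by_cases hp : p i
    · obtain ⟨g, hg, h⟩ := id hp
      have hD := (sqSize_le_iff hX (h := fun q x => b i q x - a i q x)
        (fun q => (hab i q).2.1.sub (hab i q).1) (sq_nonneg v)).1 (hsz i)
      have hG := (sqSize_le_iff hX (hgm g hg) (sq_nonneg v)).1 (hgv g hg)
      have hdi : ∀ q, Integrable (fun ω => 2 * g q (X q ω) ^ 2 +
          2 * (b i q (X q ω) - a i q (X q ω)) ^ 2) P := fun q =>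
        ((hG.1 q).const_mul 2).add ((hD.1 q).const_mul 2)
      have hle : ∀ q x, u i q x ^ 2 ≤ 2 * g q x ^ 2 + 2 * (b i q x - a i q x) ^ 2 := fun q x => by
        obtain ⟨h1, h2⟩ := hcell i g hg h q x
        nlinarith [sq_nonneg (u i q x - 2 * g q x), mul_self_nonneg (u i q x - g q x)]
      have hui : ∀ q, Integrable (fun ω => u i q (X q ω) ^ 2) P := fun q =>
        (hdi q).mono' (((hum i q).pow_const 2).comp_aemeasurable (hX q)).aestronglyMeasurable
          (Filter.Eventually.of_forall fun ω => by
            rw [Real.norm_of_nonneg (sq_nonneg _)]; exact hle q _)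
      refine (sqSize_le_iff hX (hum i) (by positivity)).2 ⟨hui, ?_⟩
      calc ∑ q, ∫ ω, u i q (X q ω) ^ 2 ∂P
          ≤ ∑ q, (2 * ∫ ω, g q (X q ω) ^ 2 ∂P +
              2 * ∫ ω, (b i q (X q ω) - a i q (X q ω)) ^ 2 ∂P) := by
            refine Finset.sum_le_sum fun q _ => ?_
            rw [← integral_const_mul, ← integral_const_mul,
              ← integral_add ((hG.1 q).const_mul 2) ((hD.1 q).const_mul 2)]
            exact integral_mono (hui q) (hdi q) fun ω => hle q _
        _ ≤ 4 * v ^ 2 := by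
            rw [Finset.sum_add_distrib, ← Finset.mul_sum, ← Finset.mul_sum]
            linarith [hD.2, hG.2]
    · simp [sqSize, u, hp]
  · obtain ⟨i, hi⟩ := hc g hg
    exact ⟨i, hcell i g hg hi⟩

/-- The chain is stopped at a finite depth where the terminal error is below `e`. The bound then
depends on depth and sample size only through the entropy sum `Ψ`. -/
theorem exists_chain_bound (hX : ∀ q, AEMeasurable (X q) P) (hind : iIndepFun X P)
    {𝒢 : Set (Q → 𝒳 → ℝ)} {v τ c Ψ e : ℝ} {M : ℕ → ℕ} {h : ℕ → ℝ} {u D : Fin (M 0) → Q → 𝒳 → ℝ}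
    (hnet : UpperNet P X u D v) (hucell : ∀ g ∈ 𝒢, ∃ i, InCell (u i) (D i) g)
    (hgm : ∀ g ∈ 𝒢, ∀ q, Measurable (g q)) (hgτ : ∀ g ∈ 𝒢, ∀ q x, |g q x| ≤ τ)
    (hv : 0 < v) (hc : 1 ≤ c) (he : 0 < e)
    (hh : ∀ r, 0 ≤ h r) (hM : ∀ r, (M r : ℝ) ≤ Real.exp (h r ^ 2))
    (hcov : ∀ r, SqCover P X 𝒢 (v / 2 ^ r) (M r))
    (hΨ : ∀ R, ∑ s ∈ Finset.range R, v / 2 ^ s * h s ≤ Ψ) :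
    ∃ W : Ω → ℝ, (∀ ω, 0 ≤ W ω) ∧ Integrable W P ∧ ∫ ω, W ω ∂P ≤ Real.exp (-c ^ 2) * (2 * v) ∧
      ∀ g ∈ 𝒢, ∃ i, ∀ ω, centeredSum P X g ω ≤
        centeredSum P X (u i) ω + (3 * v * c + 6 * Ψ + e) + W ω := by
  obtain ⟨R, hR⟩ : ∃ R : ℕ, (1 + Fintype.card Q) * v / e < 2 ^ R :=
    pow_unbounded_of_one_lt _ one_lt_two
  have hR' : (1 + Fintype.card Q) * (v / 2 ^ R) ≤ e := by
    rw [div_lt_iff₀ he] at hR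
    rw [← mul_div_assoc, div_le_iff₀ (by positivity)]
    linarith
  have hv' : 0 < v / 2 ^ R := by positivity
  obtain ⟨κ, _, u', D', W, hnet', -, hW, hWi, hWE, hch⟩ :=
    exists_chain hX hind hnet hv hc hh (by simpa using hM 0) hM hcov R
  refine ⟨W, hW, hWi, hWE.trans (mul_le_mul_of_nonneg_left (by linarith) (Real.exp_pos _).le),
    fun g hg => ?_⟩
  obtain ⟨i, hi⟩ := hucell g hg
  obtain ⟨j, hj, hjb⟩ := hch i g hg hi
  refine ⟨i, fun ω => ?_⟩
  have hgi : ∀ q, Integrable (fun ω => g q (X q ω)) P := fun q =>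
    integrable_of_abs_le ((hgm g hg q).comp_aemeasurable (hX q)).aestronglyMeasurable
      fun ω => hgτ g hg q _
  have h1 := centeredSum_le_of_inCell hX hv' hnet' hgi hj ω
  have h2 := hjb ω
  have h3 := hΨ (R + 1)
  rw [Finset.sum_range_succ'] at h3
  simp only [pow_zero, div_one] at h3
  have h4 : 0 ≤ 3 * (v / 2 ^ R) * (c + ∑ s ∈ Finset.range (R + 1), h s) := by
    have := Finset.sum_nonneg fun s (_ : s ∈ Finset.range (R + 1)) => hh s
    have : 0 ≤ c := by linarith
    positivity
  have h5 : 0 ≤ v * h 0 := mul_nonneg hv.le (hh 0)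
  nlinarith

/-- Uniform bound for the centered sums over an `L²` ball of uniformly bounded functions. -/
theorem exists_ball_bound (hX : ∀ q, AEMeasurable (X q) P) (hind : iIndepFun X P)
    {𝒢 : Set (Q → 𝒳 → ℝ)} {v τ c Ψ e lm : ℝ} {M : ℕ → ℕ} {h : ℕ → ℝ} (hτ : 0 ≤ τ)
    (hgm : ∀ g ∈ 𝒢, ∀ q, Measurable (g q)) (hgτ : ∀ g ∈ 𝒢, ∀ q x, |g q x| ≤ τ)
    (hgv : ∀ g ∈ 𝒢, sqSize P X g ≤ ENNReal.ofReal (v ^ 2))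
    (hv : 0 < v) (hc : 1 ≤ c) (he : 0 < e) (hl : 0 < lm) (hl1 : lm ≤ 1)
    (hh : ∀ r, 0 ≤ h r) (hM : ∀ r, (M r : ℝ) ≤ Real.exp (h r ^ 2))
    (hcov : ∀ r, SqCover P X 𝒢 (v / 2 ^ r) (M r))
    (hΨ : ∀ R, ∑ s ∈ Finset.range R, v / 2 ^ s * h s ≤ Ψ) :
    ∃ W : Ω → ℝ, (∀ ω, 0 ≤ W ω) ∧ Integrable W P ∧
      ∫ ω, W ω ∂P ≤ Real.exp (-c ^ 2) * (1 / lm + 2 * v) ∧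
      ∀ g ∈ 𝒢, ∀ ω, centeredSum P X g ω ≤ 4 * lm * Real.exp τ * v ^ 2 + (h 0 ^ 2 + c ^ 2) / lm +
        3 * v * c + 6 * Ψ + e + W ω := by
  obtain ⟨u, D, hnet, huτ, husq, hucell⟩ :=
    exists_initial_net hX hτ hgm hgτ hgv (by simpa using hcov 0)
  obtain ⟨W₁, hW₁, hWi₁, hWE₁, hb₁⟩ :=
    exists_chain_bound hX hind hnet hucell hgm hgτ hv hc he hh hM hcov hΨ
  have hsq := fun i => (sqSize_le_iff hX (hnet.meas_u i) (by positivity)).1 (husq i)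
  have hz : ∀ i q x, lm * u i q x ≤ τ := fun i q x => by
    have := (abs_le.1 (huτ i q x)).2
    nlinarith
  have hexpi : ∀ i q, Integrable (fun ω => Real.exp (lm * u i q (X q ω))) P := fun i q =>
    (integrable_const (Real.exp τ)).mono'
      (Real.measurable_exp.comp_aemeasurable
        (((hnet.meas_u i q).const_mul lm).comp_aemeasurable (hX q))).aestronglyMeasurable
      (Filter.Eventually.of_forall fun ω => by
        rw [Real.norm_of_nonneg (Real.exp_pos _).le]
        exact Real.exp_le_exp.2 (hz i q _))
  have hmgf : ∀ i, Integrable (fun ω => Real.exp (lm * centeredSum P X (u i) ω)) P ∧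
      ∫ ω, Real.exp (lm * centeredSum P X (u i) ω) ∂P ≤
        Real.exp (4 * lm ^ 2 * Real.exp τ * v ^ 2) := fun i => by
    have := integral_exp_centeredSum_le hX hind (hnet.meas_u i) (hexpi i)
      (V := fun q => lm ^ 2 * Real.exp τ * ∫ ω, u i q (X q ω) ^ 2 ∂P) (fun q => by
        have hI := integral_one_add_mul_add_mul (hnet.int_u i q) ((hsq i).1 q) lm
          (lm ^ 2 * Real.exp τ)
        rw [← hI.2]
        refine integral_mono (hexpi i q) hI.1 fun ω => ?_
        have := exp_le_of_le hτ (hz i q (X q ω))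
        show Real.exp (lm * u i q (X q ω)) ≤ _
        linarith)
    refine ⟨this.1, this.2.trans (Real.exp_le_exp.2 ?_)⟩
    rw [← Finset.mul_sum]
    calc _ ≤ lm ^ 2 * Real.exp τ * (4 * v ^ 2) :=
          mul_le_mul_of_nonneg_left (hsq i).2 (by positivity)
      _ = _ := by ring
  -- The initial functions have no sign, so a Bernstein-type moment bound using |u| ≤ τ replaces the
  -- one-sided one. The level cancels that moment, the exp(h 0 ²) functions of the net, and leaves
  -- exp(-c²); `lm` stays free to keep the v² term small.
  obtain ⟨W₀, hW₀, hWi₀, hWE₀, hb₀⟩ := exists_remainder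
    (b := 4 * lm * Real.exp τ * v ^ 2 + (h 0 ^ 2 + c ^ 2) / lm) hl
    (fun i => integrable_centeredSum (hnet.int_u i)) (fun i => (hmgf i).1) (fun i => (hmgf i).2)
  refine ⟨fun ω => W₀ ω + W₁ ω, fun ω => add_nonneg (hW₀ ω) (hW₁ ω), hWi₀.add hWi₁, ?_,
    fun g hg ω => ?_⟩
  · rw [integral_add hWi₀ hWi₁, mul_add]
    refine add_le_add (hWE₀.trans ?_) hWE₁
    rw [mul_one_div]
    refine div_le_div_of_nonneg_right ?_ hl.le
    rw [Fintype.card_fin]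
    calc _ ≤ Real.exp (h 0 ^ 2) * Real.exp (4 * lm ^ 2 * Real.exp τ * v ^ 2) *
          Real.exp (-(lm * (4 * lm * Real.exp τ * v ^ 2 + (h 0 ^ 2 + c ^ 2) / lm))) := by
          gcongr; exact hM 0
      _ = Real.exp (-c ^ 2) := by
          rw [← Real.exp_add, ← Real.exp_add]; congr 1; field_simp; ring
      _ ≤ _ := le_rfl
  · obtain ⟨i, hi⟩ := hb₁ g hg
    linarith [hi ω, hb₀ i ω]

/-- Uniform bound for the centered sums over an `L²` ball that lies in a single bracket. -/
theorem exists_single_bracket_bound (hX : ∀ q, AEMeasurable (X q) P) (hind : iIndepFun X P)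
    {𝒢 : Set (Q → 𝒳 → ℝ)} {v τ Ψ e : ℝ} {M : ℕ → ℕ} {h : ℕ → ℝ} (hτ : 0 ≤ τ)
    (hgm : ∀ g ∈ 𝒢, ∀ q, Measurable (g q)) (hgτ : ∀ g ∈ 𝒢, ∀ q x, |g q x| ≤ τ)
    (hgv : ∀ g ∈ 𝒢, sqSize P X g ≤ ENNReal.ofReal (v ^ 2)) (hv : 0 < v) (he : 0 < e)
    (hh : ∀ r, 0 ≤ h r) (hM : ∀ r, (M r : ℝ) ≤ Real.exp (h r ^ 2)) (hM0 : M 0 ≤ 1)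
    (hcov : ∀ r, SqCover P X 𝒢 (v / 2 ^ r) (M r))
    (hΨ : ∀ R, ∑ s ∈ Finset.range R, v / 2 ^ s * h s ≤ Ψ) :
    ∃ W : Ω → ℝ, Integrable W P ∧ ∫ ω, W ω ∂P ≤ 2 * v ∧
      ∀ g ∈ 𝒢, ∀ ω, centeredSum P X g ω ≤ 3 * v + 6 * Ψ + e + W ω := by
  obtain ⟨u, D, hnet, -, -, hucell⟩ :=
    exists_initial_net hX hτ hgm hgτ hgv (by simpa using hcov 0)
  obtain ⟨W, hW, hWi, hWE, hb⟩ :=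
    exists_chain_bound hX hind hnet hucell hgm hgτ hv le_rfl he hh hM hcov hΨ
  have hi : Integrable (fun ω => ∑ i, centeredSum P X (u i) ω) P :=
    integrable_finsetSum _ fun i _ => integrable_centeredSum (hnet.int_u i)
  -- With at most one initial upper function, its centered sum can go into the remainder as it
  -- stands: it has mean zero, so the initial step costs nothing and no factor depending on `τ`
  -- appears.
  refine ⟨fun ω => ∑ i, centeredSum P X (u i) ω + W ω, hi.add hWi, ?_, fun g hg ω => ?_⟩
  · rw [integral_add hi hWi, integral_finsetSum _ fun i _ => integrable_centeredSum (hnet.int_u i),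
      Finset.sum_eq_zero fun i _ => integral_centeredSum (hnet.int_u i), zero_add]
    refine hWE.trans ?_
    have : Real.exp (-1 ^ 2) ≤ 1 := Real.exp_le_one_iff.2 (by norm_num)
    nlinarith
  · obtain ⟨i, hi⟩ := hb g hg
    have : Subsingleton (Fin (M 0)) := Fin.subsingleton_iff_le_one.2 hM0
    show _ ≤ 3 * v + 6 * Ψ + e + (∑ i, centeredSum P X (u i) ω + W ω)
    rw [Fintype.sum_subsingleton _ i]
    linarith [hi ω]

end Ball

/-! ### Moments of log-likelihood ratios -/

section LogRatio

/-- A variable `U ≥ -τ` with `E[e^U] ≤ 1` has its second moment and its exponential moments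
controlled by `-E[U]`. -/
theorem logRatio_moments {Ω : Type*} [MeasurableSpace Ω] {P : Measure Ω} [IsProbabilityMeasure P]
    {U : Ω → ℝ} {τ : ℝ} (hU : AEMeasurable U P) (hτ : 0 ≤ τ) (hlow : ∀ᵐ ω ∂P, -τ ≤ U ω)
    (hexp : ∫⁻ ω, ENNReal.ofReal (Real.exp (U ω)) ∂P ≤ 1) :
    Integrable U P ∧ 0 ≤ -∫ ω, U ω ∂P ∧ Integrable (fun ω => U ω ^ 2) P ∧
      ∫ ω, U ω ^ 2 ∂P ≤ 4 * Real.exp τ * (-∫ ω, U ω ∂P) ∧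
      ∀ lm : ℝ, 0 ≤ lm → lm ≤ 1 → Integrable (fun ω => Real.exp (lm * U ω)) P ∧
        ∫ ω, Real.exp (lm * U ω) ∂P ≤
          1 + lm * ∫ ω, U ω ∂P + 2 * lm ^ 2 * Real.exp τ * (-∫ ω, U ω ∂P) := by
  have hem : AEStronglyMeasurable (fun ω => Real.exp (U ω)) P :=
    (Real.measurable_exp.comp_aemeasurable hU).aestronglyMeasurable
  have hei : Integrable (fun ω => Real.exp (U ω)) P :=
    (lintegral_ofReal_ne_top_iff_integrable hem
      (Filter.Eventually.of_forall fun ω => (Real.exp_pos _).le)).1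
      (ne_top_of_le_ne_top ENNReal.one_ne_top hexp)
  have he1 : ∫ ω, Real.exp (U ω) ∂P ≤ 1 := by
    rw [← ofReal_integral_eq_lintegral_ofReal hei
      (Filter.Eventually.of_forall fun ω => (Real.exp_pos _).le)] at hexp
    exact ENNReal.ofReal_le_one.1 hexp
  have hUi : Integrable U P := by
    refine (hei.add (integrable_const τ)).mono' hU.aestronglyMeasurable ?_
    filter_upwards [hlow] with ω hω
    have := Real.add_one_le_exp (U ω)
    show |U ω| ≤ Real.exp (U ω) + τ
    exact abs_le.2 ⟨by linarith [Real.exp_pos (U ω)], by linarith⟩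
  have hGi : Integrable (fun ω => Real.exp (U ω) - 1 - U ω) P :=
    (hei.sub (integrable_const 1)).sub hUi
  -- Since E[exp U] ≤ 1, the mean of the gap exp U - 1 - U is at most -E[U]. The pointwise
  -- inequalities in terms of this gap give all the moments.
  have hG : ∫ ω, (Real.exp (U ω) - 1 - U ω) ∂P ≤ -∫ ω, U ω ∂P := by
    rw [integral_sub (f := fun ω => Real.exp (U ω) - 1) (hei.sub (integrable_const 1)) hUi,
      integral_sub hei (integrable_const 1)]
    simp only [integral_const, probReal_univ, smul_eq_mul, mul_one]
    linarith
  have hG0 : 0 ≤ ∫ ω, (Real.exp (U ω) - 1 - U ω) ∂P :=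
    integral_nonneg fun ω => by
      have := Real.add_one_le_exp (U ω)
      show (0:ℝ) ≤ Real.exp (U ω) - 1 - U ω
      linarith
  have hsqi : Integrable (fun ω => U ω ^ 2) P := by
    refine (hGi.const_mul (4 * Real.exp τ)).mono' (hU.pow_const 2).aestronglyMeasurable ?_
    filter_upwards [hlow] with ω hω
    rw [Real.norm_of_nonneg (sq_nonneg _)]
    exact sq_le_exp_sub hτ hω
  refine ⟨hUi, hG0.trans hG, hsqi, ?_, fun lm h0 h1 => ?_⟩
  · calc ∫ ω, U ω ^ 2 ∂P ≤ ∫ ω, 4 * Real.exp τ * (Real.exp (U ω) - 1 - U ω) ∂P := by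
          refine integral_mono_ae hsqi (hGi.const_mul _) ?_
          filter_upwards [hlow] with ω hω using sq_le_exp_sub hτ hω
      _ ≤ _ := by
          rw [integral_const_mul]
          exact mul_le_mul_of_nonneg_left hG (by positivity)
  · have hI := integral_one_add_mul_add_mul hUi hGi lm (2 * lm ^ 2 * Real.exp τ)
    have hle : ∀ᵐ ω ∂P, Real.exp (lm * U ω) ≤
        1 + lm * U ω + 2 * lm ^ 2 * Real.exp τ * (Real.exp (U ω) - 1 - U ω) := by
      filter_upwards [hlow] with ω hω using exp_mul_le_exp_sub hτ hω h0 h1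
    have hi : Integrable (fun ω => Real.exp (lm * U ω)) P := by
      refine hI.1.mono' (Real.measurable_exp.comp_aemeasurable
        (hU.const_mul lm)).aestronglyMeasurable ?_
      filter_upwards [hle] with ω hω
      rwa [Real.norm_of_nonneg (Real.exp_pos _).le]
    refine ⟨hi, (integral_mono_ae hi hI.1 hle).trans ?_⟩
    rw [hI.2]
    have := mul_le_mul_of_nonneg_left hG (by positivity : 0 ≤ 2 * lm ^ 2 * Real.exp τ)
    linarith

variable {𝒳 : Type*} [MeasurableSpace 𝒳] {lam : Measure 𝒳} {s f : 𝒳 → ℝ}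

theorem IsDensity.isProbabilityMeasure_law (hs : IsDensity lam s) :
    IsProbabilityMeasure (law lam s) :=
  ⟨by rw [law, withDensity_apply _ MeasurableSet.univ, Measure.restrict_univ,
    hs.lintegral_eq_one]⟩

theorem IsDensity.ae_pos (hs : IsDensity lam s) : ∀ᵐ x ∂(law lam s), 0 < s x := by
  rw [law, ae_withDensity_iff hs.measurable.ennreal_ofReal]
  refine Filter.Eventually.of_forall fun x hx => ?_
  rwa [ne_eq, ENNReal.ofReal_eq_zero, not_le] at hx

theorem ae_neg_le_log_sub {τ : ℝ} (hs : IsDensity lam s)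
    (h : ∀ x, Real.exp (-τ) * s x ≤ f x) :
    ∀ᵐ x ∂(law lam s), -τ ≤ Real.log (f x) - Real.log (s x) := by
  filter_upwards [hs.ae_pos] with x hx
  have h1 : 0 < Real.exp (-τ) * s x := mul_pos (Real.exp_pos _) hx
  have h2 := Real.log_le_log h1 (h x)
  rw [Real.log_mul (Real.exp_pos _).ne' hx.ne', Real.log_exp] at h2
  linarith

/-- The integrand against `s` is `f` on {s > 0}; `f` may carry mass on {s = 0}, hence an inequality.
There the default value log 0 = 0 has weight zero. -/
theorem lintegral_exp_log_sub_le (hs : IsDensity lam s) (hf : IsDensity lam f)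
    (hpos : ∀ x, 0 < f x) :
    ∫⁻ x, ENNReal.ofReal (Real.exp (Real.log (f x) - Real.log (s x))) ∂(law lam s) ≤ 1 := by
  have hm : Measurable fun x => ENNReal.ofReal (Real.exp (Real.log (f x) - Real.log (s x))) :=
    (Real.measurable_exp.comp (hf.measurable.log.sub hs.measurable.log)).ennreal_ofReal
  rw [law, lintegral_withDensity_eq_lintegral_mul _ hs.measurable.ennreal_ofReal hm,
    ← hf.lintegral_eq_one]
  refine lintegral_mono fun x => ?_
  rw [Pi.mul_apply, ← ENNReal.ofReal_mul (hs.nonneg x)]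
  refine ENNReal.ofReal_le_ofReal ?_
  rcases (hs.nonneg x).eq_or_lt with h | h
  · rw [← h, zero_mul]; exact hf.nonneg x
  · rw [Real.exp_sub, Real.exp_log (hpos x), Real.exp_log h]
    field_simp
    exact le_rfl

/-- Positivity of `f` gives absolute continuity with density s/f, and the lower bound on f/s gives
integrability of the log-ratio through `logRatio_moments`. -/
theorem klDiv_law_eq {τ : ℝ} (hτ : 0 ≤ τ) (hs : IsDensity lam s) (hf : IsDensity lam f)
    (hpos : ∀ x, 0 < f x) (h : ∀ x, Real.exp (-τ) * s x ≤ f x) :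
    InformationTheory.klDiv (law lam s) (law lam f) =
      ENNReal.ofReal (-∫ x, (Real.log (f x) - Real.log (s x)) ∂(law lam s)) := by
  have := hs.isProbabilityMeasure_law
  have := hf.isProbabilityMeasure_law
  have hrm : Measurable fun x => ENNReal.ofReal (s x / f x) :=
    (hs.measurable.div hf.measurable).ennreal_ofReal
  have heq : law lam s = (law lam f).withDensity fun x => ENNReal.ofReal (s x / f x) := by
    rw [law, law, ← withDensity_mul _ hf.measurable.ennreal_ofReal hrm]
    congr 1
    funext x
    rw [Pi.mul_apply, ← ENNReal.ofReal_mul (hpos x).le]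
    congr 1
    have := (hpos x).ne'
    field_simp
  have hac : law lam s ≪ law lam f := heq ▸ withDensity_absolutelyContinuous _ _
  have hrn : (law lam s).rnDeriv (law lam f) =ᵐ[law lam f] fun x => ENNReal.ofReal (s x / f x) := by
    rw [heq]; exact Measure.rnDeriv_withDensity _ hrm
  have hllr : llr (law lam s) (law lam f) =ᵐ[law lam s]
      fun x => -(Real.log (f x) - Real.log (s x)) := by
    filter_upwards [hac.ae_le hrn, hs.ae_pos] with x hx hsx
    rw [llr, hx, ENNReal.toReal_ofReal (div_nonneg hsx.le (hpos x).le),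
      Real.log_div hsx.ne' (hpos x).ne']
    ring
  have hmom := logRatio_moments (P := law lam s)
    (hf.measurable.log.sub hs.measurable.log).aemeasurable hτ (ae_neg_le_log_sub hs h)
    (lintegral_exp_log_sub_le hs hf hpos)
  rw [InformationTheory.klDiv_of_ac_of_integrable hac ((integrable_congr hllr).2 hmom.1.neg),
    integral_congr_ae hllr, integral_neg]
  simp

end LogRatio

/-! ### From the entropy integral to dyadic covers -/

section Entropy

/-- Each interval (ρ/2^(r+1), ρ/2^r] has length ρ/2^(r+1), and `H` is at least its right-end value
there. The leftover integral near zero makes the induction close. -/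
theorem sum_dyadic_mul_le_lintegral {H : ℝ → ℝ≥0∞} (hH : ∀ a b, 0 < a → a ≤ b → H b ≤ H a)
    {ρ : ℝ} (hρ : 0 < ρ) (R : ℕ) :
    ∑ r ∈ Finset.range R, ENNReal.ofReal (ρ / 2 ^ (r + 1)) * H (ρ / 2 ^ r) ≤
      ∫⁻ δ in Set.Ioc 0 ρ, H δ := by
  suffices h : ∑ r ∈ Finset.range R, ENNReal.ofReal (ρ / 2 ^ (r + 1)) * H (ρ / 2 ^ r) +
      ∫⁻ δ in Set.Ioc 0 (ρ / 2 ^ R), H δ ≤ ∫⁻ δ in Set.Ioc 0 ρ, H δ from le_self_add.trans h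
  induction R with
  | zero => simp
  | succ R ih =>
    have hpos : 0 < ρ / 2 ^ (R + 1) := by positivity
    have hhalf : ρ / 2 ^ R = ρ / 2 ^ (R + 1) + ρ / 2 ^ (R + 1) := by rw [pow_succ]; field_simp; ring
    have hsplit : ∫⁻ δ in Set.Ioc 0 (ρ / 2 ^ R), H δ =
        (∫⁻ δ in Set.Ioc 0 (ρ / 2 ^ (R + 1)), H δ) +
          ∫⁻ δ in Set.Ioc (ρ / 2 ^ (R + 1)) (ρ / 2 ^ R), H δ := by
      rw [← Set.Ioc_union_Ioc_eq_Ioc hpos.le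
        (by rw [hhalf]; linarith : ρ / 2 ^ (R + 1) ≤ ρ / 2 ^ R)]
      exact lintegral_union measurableSet_Ioc (Set.Ioc_disjoint_Ioc_of_le le_rfl)
    have hlow : ENNReal.ofReal (ρ / 2 ^ (R + 1)) * H (ρ / 2 ^ R) ≤
        ∫⁻ δ in Set.Ioc (ρ / 2 ^ (R + 1)) (ρ / 2 ^ R), H δ := by
      calc _ = ∫⁻ _ in Set.Ioc (ρ / 2 ^ (R + 1)) (ρ / 2 ^ R), H (ρ / 2 ^ R) := by
            rw [setLIntegral_const, Real.volume_Ioc, hhalf, add_sub_cancel_right, mul_comm]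
        _ ≤ _ := setLIntegral_mono' measurableSet_Ioc fun δ hδ =>
            hH _ _ (hpos.trans hδ.1) hδ.2
    refine le_trans ?_ ih
    rw [Finset.sum_range_succ, add_assoc, hsplit]
    refine add_le_add le_rfl ?_
    rw [add_comm]
    exact add_le_add le_rfl hlow

variable {𝒳 : Type*} [MeasurableSpace 𝒳] {lam : Measure 𝒳} {K L : ℕ} {N : Fin L → ℕ}
  {s : Fin L → 𝒳 → ℝ} {k : Fin L → Fin K} {G F : Set (Fin K → 𝒳 → ℝ)}

theorem BracketCover.mono {δ δ' : ℝ} {M : ℕ} (h : BracketCover lam N s k δ G M) (h0 : 0 ≤ δ)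
    (hle : δ ≤ δ') : BracketCover lam N s k δ' G M := by
  obtain ⟨fm, fp, h1, h2⟩ := h
  refine ⟨fm, fp, fun i => ⟨(h1 i).1, (h1 i).2.trans ?_⟩, h2⟩
  exact ENNReal.ofReal_le_ofReal (pow_le_pow_left₀ h0 hle 2)

theorem bracketEntropy_anti {δ δ' : ℝ} (h0 : 0 ≤ δ) (hle : δ ≤ δ') :
    bracketEntropy lam N s k δ' G ≤ bracketEntropy lam N s k δ G :=
  le_iInf₂ fun M hM => iInf₂_le M (hM.mono h0 hle)

/-- The infimum is attained at the least admissible cardinality, because the logarithm is monotone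
on the naturals, including log 0 = 0. -/
theorem exists_bracketCover {δ : ℝ} (h : bracketEntropy lam N s k δ G ≠ ∞) :
    ∃ M : ℕ, BracketCover lam N s k δ G M ∧
      bracketEntropy lam N s k δ G = ENNReal.ofReal (Real.log M) := by
  classical
  have hex : ∃ M, BracketCover lam N s k δ G M := by
    by_contra hc
    push Not at hc
    exact h (by simp [bracketEntropy, hc])
  refine ⟨Nat.find hex, Nat.find_spec hex, le_antisymm (iInf₂_le _ (Nat.find_spec hex))
    (le_iInf₂ fun M hM => ENNReal.ofReal_le_ofReal ?_)⟩
  rcases Nat.eq_zero_or_pos (Nat.find hex) with h0 | h0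
  · rw [h0]; simpa using Real.log_natCast_nonneg M
  · exact Real.log_le_log (by exact_mod_cast h0) (by exact_mod_cast Nat.find_min' hex hM)

/-- Covers at dyadic scales with summable root entropies. -/
theorem exists_dyadic_covers {φ : ℝ → ℝ} {ρ : ℝ} (hφ : 0 ≤ φ ρ) (hρ : 0 < ρ)
    (hint : ∫⁻ δ in Set.Ioc 0 ρ, bracketEntropy lam N s k δ G ^ (1 / 2 : ℝ) ≤
      ENNReal.ofReal (φ ρ)) :
    ∃ (M : ℕ → ℕ) (h : ℕ → ℝ), (∀ r, 0 ≤ h r) ∧ (∀ r, Real.log (M r) = h r ^ 2) ∧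
      (∀ r, (M r : ℝ) ≤ Real.exp (h r ^ 2)) ∧
      (∀ r, BracketCover lam N s k (ρ / 2 ^ r) G (M r)) ∧
      ∀ R, ∑ r ∈ Finset.range R, ρ / 2 ^ r * h r ≤ 2 * φ ρ := by
  have hsum := fun R => (sum_dyadic_mul_le_lintegral
    (H := fun δ => bracketEntropy lam N s k δ G ^ (1 / 2 : ℝ))
    (fun a b ha hab => ENNReal.rpow_le_rpow (bracketEntropy_anti ha.le hab) (by norm_num))
    hρ R).trans hint
  have hfin : ∀ r, bracketEntropy lam N s k (ρ / 2 ^ r) G ≠ ∞ := fun r hc => by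
    have h1 := hsum (r + 1)
    rw [Finset.sum_range_succ, hc, ENNReal.top_rpow_of_pos (by norm_num), ENNReal.mul_top
      (ENNReal.ofReal_pos.2 (by positivity)).ne', add_top] at h1
    exact ENNReal.ofReal_ne_top (top_le_iff.1 h1)
  choose M hM hME using fun r => exists_bracketCover (hfin r)
  have hlog : ∀ r, 0 ≤ Real.log (M r) := fun r => Real.log_natCast_nonneg _
  refine ⟨M, fun r => Real.sqrt (Real.log (M r)), fun r => Real.sqrt_nonneg _,
    fun r => (Real.sq_sqrt (hlog r)).symm, fun r => ?_, hM, fun R => ?_⟩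
  · rw [Real.sq_sqrt (hlog r)]
    -- An empty family has entropy log 0 = 0, so the cardinality bound is checked apart.
    rcases Nat.eq_zero_or_pos (M r) with h0 | h0
    · simp [h0]
    · rw [Real.exp_log (by exact_mod_cast h0)]
  · have h1 := hsum R
    have h2 : ∀ r, ENNReal.ofReal (ρ / 2 ^ (r + 1)) *
        bracketEntropy lam N s k (ρ / 2 ^ r) G ^ (1 / 2 : ℝ) =
        ENNReal.ofReal (ρ / 2 ^ r * Real.sqrt (Real.log (M r)) / 2) := fun r => by
      rw [hME, ENNReal.ofReal_rpow_of_nonneg (hlog r) (by norm_num), ← Real.sqrt_eq_rpow,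
        ← ENNReal.ofReal_mul (by positivity)]
      congr 1
      rw [pow_succ]; field_simp
    simp only [h2] at h1
    rw [← ENNReal.ofReal_sum_of_nonneg fun r _ => by positivity,
      ENNReal.ofReal_le_ofReal_iff hφ, ← Finset.sum_div] at h1
    linarith

end Entropy

/-! ### The observations -/

section Observations

variable {Ω 𝒳 : Type*} [MeasurableSpace Ω] [MeasurableSpace 𝒳] {P : Measure Ω}
  {lam : Measure 𝒳} {K L : ℕ} {N : Fin L → ℕ} {s : Fin L → 𝒳 → ℝ}
  {X : ((l : Fin L) × Fin (N l)) → Ω → 𝒳} {F : Set (Fin K → 𝒳 → ℝ)}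

/-- `log f - log g` along the assignment `k`. -/
noncomputable def logDiff (k : Fin L → Fin K) (f g : Fin K → 𝒳 → ℝ)
    (q : (l : Fin L) × Fin (N l)) (x : 𝒳) : ℝ :=
  Real.log (f (k q.1) x) - Real.log (g (k q.1) x)

/-- `log f - log s` along the assignment `k`. -/
noncomputable def logLik (s : Fin L → 𝒳 → ℝ) (k : Fin L → Fin K) (f : Fin K → 𝒳 → ℝ)
    (q : (l : Fin L) × Fin (N l)) (x : 𝒳) : ℝ :=
  Real.log (f (k q.1) x) - Real.log (s q.1 x)

/-- The unnormalized Kullback-Leibler loss `∑_l n_l KL(s_l, f_{k_l})`. -/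
noncomputable def klSum (P : Measure Ω) (X : ((l : Fin L) × Fin (N l)) → Ω → 𝒳)
    (s : Fin L → 𝒳 → ℝ) (f : Fin K → 𝒳 → ℝ) (k : Fin L → Fin K) : ℝ :=
  -∑ q, ∫ ω, logLik s k f q (X q ω) ∂P

theorem card_index : Fintype.card ((l : Fin L) × Fin (N l)) = total N := by
  simp [total]

theorem sum_index_div {n : ℝ≥0∞} (w : Fin L → ℝ≥0∞) :
    ∑ q : (l : Fin L) × Fin (N l), w q.1 / n = ∑ l, (N l : ℝ≥0∞) / n * w l := by
  rw [Fintype.sum_sigma]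
  refine Finset.sum_congr rfl fun l _ => ?_
  simp only [Finset.sum_const, Finset.card_univ, Fintype.card_fin, nsmul_eq_mul]
  rw [div_eq_mul_inv, div_eq_mul_inv]
  ring

theorem sqSize_logDiff (hlaw : ∀ q, HasLaw (X q) (law lam (s q.1)) P) (hn : 0 < total N)
    {k : Fin L → Fin K} {f g : Fin K → 𝒳 → ℝ} (hfm : ∀ j, Measurable (f j))
    (hgm : ∀ j, Measurable (g j)) (hf : ∀ j x, 0 < f j x) (hg : ∀ j x, 0 < g j x) :
    sqSize P X (logDiff k g f) = total N * aDiv lam N s k f g := by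
  have hn0 : (total N : ℝ≥0∞) ≠ 0 := by exact_mod_cast hn.ne'
  unfold aDiv
  rw [← sum_index_div, Finset.mul_sum]
  refine Finset.sum_congr rfl fun q _ => ?_
  rw [ENNReal.mul_div_cancel hn0 (ENNReal.natCast_ne_top _)]
  rw [← (hlaw q).lintegral_comp (f := fun x =>
    ENNReal.ofReal (|Real.log (f (k q.1) x / g (k q.1) x)| ^ 2))
    ((((hfm _).div (hgm _)).log.abs.pow_const 2).ennreal_ofReal).aemeasurable]
  refine lintegral_congr fun ω => ?_
  rw [sq_abs, Real.log_div (hf _ _).ne' (hg _ _).ne']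
  congr 1
  simp only [logDiff]
  ring

theorem sqSize_logDiff_le_iff (hlaw : ∀ q, HasLaw (X q) (law lam (s q.1)) P) (hn : 0 < total N)
    {k : Fin L → Fin K} {f g : Fin K → 𝒳 → ℝ} (hfm : ∀ j, Measurable (f j))
    (hgm : ∀ j, Measurable (g j)) (hf : ∀ j x, 0 < f j x) (hg : ∀ j x, 0 < g j x) (δ : ℝ) :
    sqSize P X (logDiff k g f) ≤ ENNReal.ofReal ((Real.sqrt (total N) * δ) ^ 2) ↔
      aDiv lam N s k f g ≤ ENNReal.ofReal (δ ^ 2) := by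
  rw [sqSize_logDiff hlaw hn hfm hgm hf hg, mul_pow, Real.sq_sqrt (Nat.cast_nonneg _),
    ENNReal.ofReal_mul (Nat.cast_nonneg _), ENNReal.ofReal_natCast]
  exact ENNReal.mul_le_mul_iff_right (by exact_mod_cast hn.ne') (ENNReal.natCast_ne_top _)

/-- The logarithm is monotone, and the shift by log f₀ cancels in the width of a bracket. The factor
√n is the passage from the averaged divergence to the sum over observations. -/
theorem BracketCover.sqCover (hlaw : ∀ q, HasLaw (X q) (law lam (s q.1)) P) (hn : 0 < total N)
    {k : Fin L → Fin K} {G : Set (Fin K → 𝒳 → ℝ)} {f₀ : Fin K → 𝒳 → ℝ} {δ : ℝ} {M : ℕ}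
    (hG : ∀ f ∈ G, ∀ j x, 0 < f j x) (hf₀ : ∀ j, Measurable (f₀ j))
    (h : BracketCover lam N s k δ G M) :
    SqCover P X ((fun f => logDiff k f f₀) '' G) (Real.sqrt (total N) * δ) M := by
  obtain ⟨fm, fp, h1, h2⟩ := h
  refine ⟨fun i => logDiff k (fm i) f₀, fun i => logDiff k (fp i) f₀, fun i q => ?_, fun i => ?_,
    ?_⟩
  · obtain ⟨hm, hp, hle⟩ := (h1 i).1 (k q.1)
    refine ⟨hm.log.sub (hf₀ _).log, hp.log.sub (hf₀ _).log, fun x => ?_⟩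
    exact sub_le_sub_right (Real.log_le_log (hle x).1 (hle x).2) _
  · have hb := (h1 i).1
    have := (sqSize_logDiff_le_iff hlaw hn (fun j => (hb j).1) (fun j => (hb j).2.1)
      (fun j x => ((hb j).2.2 x).1)
      (fun j x => ((hb j).2.2 x).1.trans_le ((hb j).2.2 x).2) δ).2 (h1 i).2
    refine le_of_eq_of_le ?_ this
    congr 1
    funext q x
    simp only [logDiff]
    ring
  · rintro _ ⟨f, hf, rfl⟩
    obtain ⟨i, hi⟩ := h2 f hf
    refine ⟨i, fun q x => ⟨?_, ?_⟩⟩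
    · exact sub_le_sub_right (Real.log_le_log (((h1 i).1 (k q.1)).2.2 x).1 (hi _ x).1) _
    · exact sub_le_sub_right (Real.log_le_log (hG f hf _ x) (hi _ x).2) _

end Observations

/-! ### The likelihood inequality -/

section Likelihood

variable {𝒳 : Type*} {K L : ℕ} {N : Fin L → ℕ}

theorem sum_simplex_pos {p A : Fin K → ℝ} (hp : p ∈ stdSimplex ℝ (Fin K)) (hA : ∀ k, 0 < A k) :
    0 < ∑ k, p k * A k := by
  have h0 : ∀ k ∈ Finset.univ, 0 ≤ p k * A k := fun k _ => mul_nonneg (hp.1 k) (hA k).le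
  refine (Finset.sum_nonneg h0).lt_of_ne' fun hc => ?_
  have h1 := (Finset.sum_eq_zero_iff_of_nonneg h0).1 hc
  have h2 : ∀ k, p k = 0 := fun k => by
    simpa [(hA k).ne'] using h1 k (Finset.mem_univ k)
  have h3 := hp.2
  simp [h2] at h3

/-- An approximate minimizer of the contrast with its maximum a posteriori assignment almost
maximizes the likelihood over densities and assignments. -/
theorem sum_log_le_of_isEtaMinimizer {x : (l : Fin L) → Fin (N l) → 𝒳}
    {F : Set (Fin K → 𝒳 → ℝ)} {η : ℝ} {p : Fin K → ℝ} {f g : Fin K → 𝒳 → ℝ}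
    {k k' : Fin L → Fin K} (hF : ∀ f ∈ F, ∀ k x, 0 < f k x)
    (hmin : IsEtaMinimizer x F η p f) (hmap : IsMAP x p f k) (hg : g ∈ F) :
    ∑ l, ∑ i, Real.log (g (k' l) (x l i)) ≤
      ∑ l, ∑ i, Real.log (f (k l) (x l i)) + 2 * (L * Real.log K) + η := by
  obtain ⟨hp, hf, hle⟩ := hmin
  have hK : 0 < K := by
    rcases Nat.eq_zero_or_pos K with h | h
    · subst h
      have := hp.2
      simp at this
    · exact h
  have hKr : (0 : ℝ) < K := by exact_mod_cast hK
  have hprod : ∀ h ∈ F, ∀ l k, 0 < ∏ i, h k (x l i) := fun h hh l k =>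
    Finset.prod_pos fun i _ => hF h hh k _
  have hlogprod : ∀ h ∈ F, ∀ l k, Real.log (∏ i, h k (x l i)) = ∑ i, Real.log (h k (x l i)) :=
    fun h hh l k => Real.log_prod fun i _ => (hF h hh k _).ne'
  -- Uniform weights as competitor: they cost log K for each `l`, whatever the assignment `k'`.
  have hq : (fun _ : Fin K => (K : ℝ)⁻¹) ∈ stdSimplex ℝ (Fin K) :=
    ⟨fun _ => (inv_pos.2 hKr).le, by simp [hKr.ne']⟩
  have h1 := hle _ hq g hg
  have h2 : contrast x (fun _ : Fin K => (K : ℝ)⁻¹) g ≤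
      L * Real.log K - ∑ l, ∑ i, Real.log (g (k' l) (x l i)) := by
    have : ∀ l, -Real.log (∑ k, (K : ℝ)⁻¹ * ∏ i, g k (x l i)) ≤
        Real.log K - ∑ i, Real.log (g (k' l) (x l i)) := fun l => by
      have h3 : (K : ℝ)⁻¹ * ∏ i, g (k' l) (x l i) ≤ ∑ k, (K : ℝ)⁻¹ * ∏ i, g k (x l i) :=
        Finset.single_le_sum (f := fun k => (K : ℝ)⁻¹ * ∏ i, g k (x l i))
          (fun k _ => (mul_pos (inv_pos.2 hKr) (hprod g hg l k)).le) (Finset.mem_univ (k' l))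
      have h4 := Real.log_le_log (mul_pos (inv_pos.2 hKr) (hprod g hg l _)) h3
      rw [Real.log_mul (inv_pos.2 hKr).ne' (hprod g hg l _).ne', Real.log_inv,
        hlogprod g hg] at h4
      linarith
    calc _ ≤ ∑ l, (Real.log K - ∑ i, Real.log (g (k' l) (x l i))) :=
          Finset.sum_le_sum fun l _ => this l
      _ = _ := by simp [Finset.sum_sub_distrib]
  have h5 : -(L * Real.log K) - ∑ l, ∑ i, Real.log (f (k l) (x l i)) ≤ contrast x p f := by
    have : ∀ l, -Real.log K - ∑ i, Real.log (f (k l) (x l i)) ≤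
        -Real.log (∑ k, p k * ∏ i, f k (x l i)) := fun l => by
      -- Every term is at most the maximal one, whose weight is at most one. This is the second log
      -- K for each `l`.
      have h6 : ∑ j, p j * ∏ i, f j (x l i) ≤ K * ∏ i, f (k l) (x l i) := by
        calc _ ≤ ∑ _j : Fin K, ∏ i, f (k l) (x l i) := by
              refine Finset.sum_le_sum fun j _ => (hmap l j).trans ?_
              have h7 : p (k l) ≤ 1 := by
                rw [← hp.2]
                exact Finset.single_le_sum (fun j _ => hp.1 j) (Finset.mem_univ _)
              exact mul_le_of_le_one_left (hprod f hf l _).le h7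
          _ = _ := by simp
      have h8 := Real.log_le_log (sum_simplex_pos hp (hprod f hf l)) h6
      rw [Real.log_mul hKr.ne' (hprod f hf l _).ne', hlogprod f hf] at h8
      linarith
    calc _ = ∑ l, (-Real.log K - ∑ i, Real.log (f (k l) (x l i))) := by
          simp [Finset.sum_sub_distrib]
      _ ≤ _ := Finset.sum_le_sum fun l _ => this l
  linarith

end Likelihood

/-! ### Consequences of the lower bound assumption -/

section Setting

variable {Ω 𝒳 : Type*} [MeasurableSpace Ω] [MeasurableSpace 𝒳] {P : Measure Ω}
  {lam : Measure 𝒳} {K L : ℕ} {N : Fin L → ℕ} {s : Fin L → 𝒳 → ℝ}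
  {X : ((l : Fin L) × Fin (N l)) → Ω → 𝒳} {F : Set (Fin K → 𝒳 → ℝ)} {τ : ℝ}

/-- The observations, the model and the lower bound assumption. -/
structure Setting (P : Measure Ω) (lam : Measure 𝒳) (s : Fin L → 𝒳 → ℝ)
    (X : ((l : Fin L) × Fin (N l)) → Ω → 𝒳) (F : Set (Fin K → 𝒳 → ℝ)) (τ : ℝ) : Prop where
  hasLaw : ∀ q, HasLaw (X q) (law lam (s q.1)) P
  indep : iIndepFun X P
  density : ∀ l, IsDensity lam (s l)
  model : IsModel lam F
  ratio : RatioBound F s τ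
  tau_nonneg : 0 ≤ τ
  total_pos : 0 < total N

variable (S : Setting P lam s X F τ)
include S

theorem Setting.aemeasurable (q : (l : Fin L) × Fin (N l)) : AEMeasurable (X q) P :=
  (S.hasLaw q).aemeasurable

theorem Setting.measurable {f : Fin K → 𝒳 → ℝ} (hf : f ∈ F) (j : Fin K) : Measurable (f j) :=
  (S.model f hf j).1.measurable

theorem Setting.pos {f : Fin K → 𝒳 → ℝ} (hf : f ∈ F) (j : Fin K) (x : 𝒳) : 0 < f j x :=
  (S.model f hf j).2 x

theorem Setting.measurable_logLik {f : Fin K → 𝒳 → ℝ} (hf : f ∈ F) (k : Fin L → Fin K)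
    (q : (l : Fin L) × Fin (N l)) : Measurable (logLik s k f q) :=
  (S.measurable hf _).log.sub (S.density _).measurable.log

theorem Setting.measurable_logDiff {f g : Fin K → 𝒳 → ℝ} (hf : f ∈ F) (hg : g ∈ F)
    (k : Fin L → Fin K) (q : (l : Fin L) × Fin (N l)) : Measurable (logDiff k f g q) :=
  (S.measurable hf _).log.sub (S.measurable hg _).log

theorem Setting.logLik_moments [IsProbabilityMeasure P] {f : Fin K → 𝒳 → ℝ} (hf : f ∈ F) (k : Fin L → Fin K)
    (q : (l : Fin L) × Fin (N l)) :
    let U := fun ω => logLik s k f q (X q ω)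
    Integrable U P ∧ 0 ≤ -∫ ω, U ω ∂P ∧ Integrable (fun ω => U ω ^ 2) P ∧
      ∫ ω, U ω ^ 2 ∂P ≤ 4 * Real.exp τ * (-∫ ω, U ω ∂P) ∧
      ∀ lm : ℝ, 0 ≤ lm → lm ≤ 1 → Integrable (fun ω => Real.exp (lm * U ω)) P ∧
        ∫ ω, Real.exp (lm * U ω) ∂P ≤
          1 + lm * ∫ ω, U ω ∂P + 2 * lm ^ 2 * Real.exp τ * (-∫ ω, U ω ∂P) := by
  refine logRatio_moments ((S.measurable_logLik hf k q).comp_aemeasurable (S.aemeasurable q))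
    S.tau_nonneg ?_ ?_
  · have h1 := ae_neg_le_log_sub (S.density q.1) (fun x => S.ratio.2 f hf (k q.1) q.1 x)
    rw [← (S.hasLaw q).map_eq] at h1
    exact ae_of_ae_map (S.aemeasurable q) h1
  · have h1 := lintegral_exp_log_sub_le (S.density q.1) (S.model f hf (k q.1)).1
      (S.pos hf (k q.1))
    rwa [← (S.hasLaw q).lintegral_comp (f := fun x => ENNReal.ofReal
      (Real.exp (Real.log (f (k q.1) x) - Real.log (s q.1 x))))
      (Real.measurable_exp.comp (S.measurable_logLik hf k q)).ennreal_ofReal.aemeasurable] at h1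

theorem Setting.integrable_logLik [IsProbabilityMeasure P] {f : Fin K → 𝒳 → ℝ} (hf : f ∈ F) (k : Fin L → Fin K)
    (q : (l : Fin L) × Fin (N l)) : Integrable (fun ω => logLik s k f q (X q ω)) P :=
  (S.logLik_moments hf k q).1

theorem Setting.klSum_nonneg [IsProbabilityMeasure P] {f : Fin K → 𝒳 → ℝ} (hf : f ∈ F) (k : Fin L → Fin K) :
    0 ≤ klSum P X s f k := by
  unfold klSum
  rw [← Finset.sum_neg_distrib]
  exact Finset.sum_nonneg fun q _ => (S.logLik_moments hf k q).2.1

theorem Setting.weightedKL_eq [IsProbabilityMeasure P] {f : Fin K → 𝒳 → ℝ} (hf : f ∈ F) (k : Fin L → Fin K) :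
    weightedKL lam N s f k = ENNReal.ofReal (klSum P X s f k / total N) := by
  have hn : (0 : ℝ) < total N := by exact_mod_cast S.total_pos
  unfold weightedKL
  rw [← sum_index_div, klSum, ← Finset.sum_neg_distrib, Finset.sum_div,
    ENNReal.ofReal_sum_of_nonneg fun q _ => div_nonneg (S.logLik_moments hf k q).2.1 hn.le]
  refine Finset.sum_congr rfl fun q _ => ?_
  rw [ENNReal.ofReal_div_of_pos hn, ENNReal.ofReal_natCast, klDiv_law_eq S.tau_nonneg
    (S.density q.1) (S.model f hf (k q.1)).1 (S.pos hf (k q.1))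
    (fun x => S.ratio.2 f hf (k q.1) q.1 x)]
  congr 3
  exact ((S.hasLaw q).integral_comp
    (S.measurable_logLik hf k q).aestronglyMeasurable).symm

theorem Setting.abs_logDiff_le {f g : Fin K → 𝒳 → ℝ} (hf : f ∈ F) (hg : g ∈ F)
    (k : Fin L → Fin K) (q : (l : Fin L) × Fin (N l)) (x : 𝒳) : |logDiff k f g q x| ≤ τ := by
  obtain ⟨h1, h2⟩ := S.ratio.1 f hf g hg (k q.1) x
  have hfx := S.pos hf (k q.1) x
  have hgx := S.pos hg (k q.1) x
  have h3 := Real.log_le_log (mul_pos (Real.exp_pos _) hgx) h1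
  have h4 := Real.log_le_log hfx h2
  rw [Real.log_mul (Real.exp_pos _).ne' hgx.ne', Real.log_exp] at h3 h4
  simp only [logDiff]
  exact abs_le.2 ⟨by linarith, by linarith⟩

theorem Setting.integrable_logDiff [IsProbabilityMeasure P] {f g : Fin K → 𝒳 → ℝ} (hf : f ∈ F) (hg : g ∈ F)
    (k : Fin L → Fin K) (q : (l : Fin L) × Fin (N l)) :
    Integrable (fun ω => logDiff k f g q (X q ω)) P :=
  integrable_of_abs_le ((S.measurable_logDiff hf hg k q).comp_aemeasurable
    (S.aemeasurable q)).aestronglyMeasurable fun _ => S.abs_logDiff_le hf hg k q _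

theorem Setting.centeredSum_logLik [IsProbabilityMeasure P] {f g : Fin K → 𝒳 → ℝ} (hf : f ∈ F) (hg : g ∈ F)
    (k : Fin L → Fin K) (ω : Ω) : centeredSum P X (logLik s k f) ω =
      centeredSum P X (logLik s k g) ω + centeredSum P X (logDiff k f g) ω := by
  rw [← centeredSum_add (S.integrable_logLik hg k) (S.integrable_logDiff hf hg k)]
  congr 1
  funext q x
  simp only [logLik, logDiff]
  ring

/-- Passing through `s` with (A - B)² ≤ 2A² + 2B², each square being controlled by its
Kullback-Leibler term. This links the chaining radius to the loss. -/
theorem Setting.sqSize_logDiff_le [IsProbabilityMeasure P] {f g : Fin K → 𝒳 → ℝ} (hf : f ∈ F) (hg : g ∈ F)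
    (k : Fin L → Fin K) : sqSize P X (logDiff k f g) ≤
      ENNReal.ofReal (8 * Real.exp τ * (klSum P X s f k + klSum P X s g k)) := by
  have hmf := S.logLik_moments hf k
  have hmg := S.logLik_moments hg k
  have hle : ∀ (q : (l : Fin L) × Fin (N l)) x, logDiff k f g q x ^ 2 ≤
      2 * logLik s k f q x ^ 2 + 2 * logLik s k g q x ^ 2 := fun q x => by
    simp only [logDiff, logLik]
    nlinarith [sq_nonneg (Real.log (f (k q.1) x) - Real.log (s q.1 x) +
      (Real.log (g (k q.1) x) - Real.log (s q.1 x)))]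
  have hint : ∀ q, Integrable (fun ω => 2 * logLik s k f q (X q ω) ^ 2 +
      2 * logLik s k g q (X q ω) ^ 2) P := fun q =>
    ((hmf q).2.2.1.const_mul 2).add ((hmg q).2.2.1.const_mul 2)
  have hsqi : ∀ q, Integrable (fun ω => logDiff k f g q (X q ω) ^ 2) P := fun q =>
    (hint q).mono' (((S.measurable_logDiff hf hg k q).pow_const 2).comp_aemeasurable
      (S.aemeasurable q)).aestronglyMeasurable (Filter.Eventually.of_forall fun ω => by
        rw [Real.norm_of_nonneg (sq_nonneg _)]; exact hle q _)
  refine (sqSize_le_iff S.aemeasurable (S.measurable_logDiff hf hg k) ?_).2 ⟨hsqi, ?_⟩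
  · have := S.klSum_nonneg hf k
    have := S.klSum_nonneg hg k
    positivity
  · calc ∑ q, ∫ ω, logDiff k f g q (X q ω) ^ 2 ∂P
        ≤ ∑ q, (8 * Real.exp τ * (-∫ ω, logLik s k f q (X q ω) ∂P) +
            8 * Real.exp τ * (-∫ ω, logLik s k g q (X q ω) ∂P)) := by
          refine Finset.sum_le_sum fun q _ => ?_
          have h1 := integral_mono (hsqi q) (hint q) fun ω => hle q _
          rw [integral_add ((hmf q).2.2.1.const_mul 2) ((hmg q).2.2.1.const_mul 2),
            integral_const_mul, integral_const_mul] at h1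
          linarith [(hmf q).2.2.2.1, (hmg q).2.2.2.1]
      _ = _ := by
          rw [Finset.sum_add_distrib, ← Finset.mul_sum, ← Finset.mul_sum, Finset.sum_neg_distrib,
            Finset.sum_neg_distrib, klSum, klSum]
          ring

/-- Uniform bound over the assignments for one element of the model per assignment. -/
theorem Setting.exists_assignment_bound [IsProbabilityMeasure P] (hK : 0 < K) {f : (Fin L → Fin K) → Fin K → 𝒳 → ℝ}
    (hf : ∀ k, f k ∈ F) {lm : ℝ} (hl : 0 < lm) (hl1 : lm ≤ 1) :
    ∃ W : Ω → ℝ, (∀ ω, 0 ≤ W ω) ∧ Integrable W P ∧ ∫ ω, W ω ∂P ≤ 1 / lm ∧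
      ∀ k ω, centeredSum P X (logLik s k (f k)) ω ≤
        2 * lm * Real.exp τ * klSum P X s (f k) k + L * Real.log K / lm + W ω := by
  have hmgf : ∀ k, Integrable (fun ω => Real.exp (lm * centeredSum P X (logLik s k (f k)) ω)) P ∧
      ∫ ω, Real.exp (lm * centeredSum P X (logLik s k (f k)) ω) ∂P ≤
        Real.exp (2 * lm ^ 2 * Real.exp τ * klSum P X s (f k) k) := fun k => by
    have := integral_exp_centeredSum_le S.aemeasurable S.indep (S.measurable_logLik (hf k) k)
      (fun q => ((S.logLik_moments (hf k) k q).2.2.2.2 lm hl.le hl1).1)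
      (fun q => ((S.logLik_moments (hf k) k q).2.2.2.2 lm hl.le hl1).2)
    rwa [← Finset.mul_sum, Finset.sum_neg_distrib] at this
  have hYexp : ∀ k ω, Real.exp (lm * (centeredSum P X (logLik s k (f k)) ω -
      2 * lm * Real.exp τ * klSum P X s (f k) k)) =
      Real.exp (-(2 * lm ^ 2 * Real.exp τ * klSum P X s (f k) k)) *
        Real.exp (lm * centeredSum P X (logLik s k (f k)) ω) := fun k ω => by
    rw [← Real.exp_add]; congr 1; ring
  obtain ⟨W, hW, hWi, hWE, hb⟩ := exists_remainder (P := P)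
    (Y := fun k ω => centeredSum P X (logLik s k (f k)) ω -
      2 * lm * Real.exp τ * klSum P X s (f k) k) (b := L * Real.log K / lm) (E₀ := 1) hl
    (fun k => (integrable_centeredSum (S.integrable_logLik (hf k) k)).sub (integrable_const _))
    (fun k => by simp only [hYexp]; exact (hmgf k).1.const_mul _)
    (fun k => by
      simp only [hYexp]
      rw [integral_const_mul]
      refine (mul_le_mul_of_nonneg_left (hmgf k).2 (Real.exp_pos _).le).trans ?_
      rw [← Real.exp_add]; simp)
  refine ⟨W, hW, hWi, hWE.trans ?_, fun k ω => by linarith [hb k ω]⟩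
  have hKr : (0 : ℝ) < K := by exact_mod_cast hK
  -- The level L log K / lm exactly pays for the K^L assignments.
  have h1 : Real.exp (-(lm * (L * Real.log K / lm))) = ((K : ℝ) ^ L)⁻¹ := by
    rw [mul_div_cancel₀ _ hl.ne', Real.exp_neg, ← Real.log_pow, Real.exp_log (by positivity)]
  rw [h1]
  simp only [Fintype.card_fun, Fintype.card_fin, Nat.cast_pow, mul_one]
  rw [mul_inv_cancel₀ (by positivity)]

end Setting

/-! ### Localized balls in the model and the small complexity regime -/

section Peeling

variable {Ω 𝒳 : Type*} [MeasurableSpace Ω] [MeasurableSpace 𝒳] {P : Measure Ω}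
  {lam : Measure 𝒳} {K L : ℕ} {N : Fin L → ℕ} {s : Fin L → 𝒳 → ℝ}
  {X : ((l : Fin L) × Fin (N l)) → Ω → 𝒳} {F : Set (Fin K → 𝒳 → ℝ)} {τ : ℝ} {φ : ℝ → ℝ}

/-- Log-ratios to `f₀` of the elements of the model within squared size `v²`. -/
def logBall (P : Measure Ω) (X : ((l : Fin L) × Fin (N l)) → Ω → 𝒳)
    (F : Set (Fin K → 𝒳 → ℝ)) (k : Fin L → Fin K) (f₀ : Fin K → 𝒳 → ℝ) (v : ℝ) :
    Set (((l : Fin L) × Fin (N l)) → 𝒳 → ℝ) :=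
  {g | ∃ f ∈ F, sqSize P X (logDiff k f f₀) ≤ ENNReal.ofReal (v ^ 2) ∧ logDiff k f f₀ = g}

theorem Setting.exists_logBall_covers (S : Setting P lam s X F τ)
    (hE : EntropyIntegralBound lam N s F φ) {f₀ : Fin K → 𝒳 → ℝ} (hf₀ : f₀ ∈ F)
    (k : Fin L → Fin K) {ρ : ℝ} (hρ : 0 < ρ) :
    ∃ (M : ℕ → ℕ) (h : ℕ → ℝ), (∀ r, 0 ≤ h r) ∧ (∀ r, Real.log (M r) = h r ^ 2) ∧
      (∀ r, (M r : ℝ) ≤ Real.exp (h r ^ 2)) ∧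
      (∀ r, SqCover P X (logBall P X F k f₀ (Real.sqrt (total N) * ρ))
        (Real.sqrt (total N) * ρ / 2 ^ r) (M r)) ∧
      ∀ R, ∑ r ∈ Finset.range R, ρ / 2 ^ r * h r ≤ 2 * φ ρ := by
  obtain ⟨M, h, h1, h2, h3, h4, h5⟩ := exists_dyadic_covers (hE.nonneg ρ hρ.le) hρ
    (hE.integral_le ρ hρ.le k f₀ hf₀)
  refine ⟨M, h, h1, h2, h3, fun r => ?_, h5⟩
  have h6 := (h4 r).sqCover S.hasLaw S.total_pos (fun f hf => S.pos hf.1) (S.measurable hf₀)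
  rw [mul_div_assoc]
  have hset : logBall P X F k f₀ (Real.sqrt (total N) * ρ) =
      (fun f => logDiff k f f₀) '' localized lam N s k F f₀ ρ := by
    ext g
    constructor
    · rintro ⟨f, hf, hle, rfl⟩
      exact ⟨f, ⟨hf, (sqSize_logDiff_le_iff S.hasLaw S.total_pos (S.measurable hf₀)
        (S.measurable hf) (S.pos hf₀) (S.pos hf) ρ).1 hle⟩, rfl⟩
    · rintro ⟨f, ⟨hf, hle⟩, rfl⟩
      exact ⟨f, hf, (sqSize_logDiff_le_iff S.hasLaw S.total_pos (S.measurable hf₀)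
        (S.measurable hf) (S.pos hf₀) (S.pos hf) ρ).2 hle, rfl⟩
  rw [hset]
  exact h6

variable [IsProbabilityMeasure P]

theorem Setting.sqSize_logDiff_le_card (S : Setting P lam s X F τ) {f g : Fin K → 𝒳 → ℝ}
    (hf : f ∈ F) (hg : g ∈ F) (k : Fin L → Fin K) :
    sqSize P X (logDiff k f g) ≤ ENNReal.ofReal (total N * τ ^ 2) := by
  calc sqSize P X (logDiff k f g)
      ≤ ∑ _q : (l : Fin L) × Fin (N l), ENNReal.ofReal (τ ^ 2) := by
        refine Finset.sum_le_sum fun q _ => ?_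
        calc _ ≤ ∫⁻ _, ENNReal.ofReal (τ ^ 2) ∂P := lintegral_mono fun ω =>
              ENNReal.ofReal_le_ofReal (sq_le_sq.2 ((S.abs_logDiff_le hf hg k q _).trans
                (le_abs_self τ)))
          _ = _ := by simp
    _ = _ := by
        rw [Finset.sum_const, Finset.card_univ, card_index, nsmul_eq_mul,
          ENNReal.ofReal_mul (Nat.cast_nonneg _), ENNReal.ofReal_natCast]

/-- The first term of the dyadic sum gives h 0 ≤ 2 φ(ρ)/ρ, and the whole sum gives Ψ = 2 √n φ(ρ). -/
theorem Setting.exists_logBall_bound (S : Setting P lam s X F τ)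
    (hE : EntropyIntegralBound lam N s F φ) {f₀ : Fin K → 𝒳 → ℝ} (hf₀ : f₀ ∈ F)
    (k : Fin L → Fin K) {ρ c lm : ℝ} (hρ : 0 < ρ) (hc : 1 ≤ c) (hl : 0 < lm) (hl1 : lm ≤ 1) :
    ∃ W : Ω → ℝ, (∀ ω, 0 ≤ W ω) ∧ Integrable W P ∧
      ∫ ω, W ω ∂P ≤ Real.exp (-c ^ 2) * (1 / lm + 2 * (Real.sqrt (total N) * ρ)) ∧
      ∀ f ∈ F, sqSize P X (logDiff k f f₀) ≤ ENNReal.ofReal ((Real.sqrt (total N) * ρ) ^ 2) →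
        ∀ ω, centeredSum P X (logDiff k f f₀) ω ≤
          4 * lm * Real.exp τ * (Real.sqrt (total N) * ρ) ^ 2 +
          ((2 * (φ ρ / ρ)) ^ 2 + c ^ 2) / lm + 3 * (Real.sqrt (total N) * ρ) * c +
          12 * (Real.sqrt (total N) * φ ρ) + 1 + W ω := by
  obtain ⟨M, h, h0, -, hM, hcov, hsum⟩ := S.exists_logBall_covers hE hf₀ k hρ
  have hn : 0 < Real.sqrt (total N) := Real.sqrt_pos.2 (by exact_mod_cast S.total_pos)
  obtain ⟨W, hW, hWi, hWE, hb⟩ := exists_ball_bound (τ := τ) (Ψ := Real.sqrt (total N) * (2 * φ ρ))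
    S.aemeasurable S.indep S.tau_nonneg
    (by rintro _ ⟨f, hf, -, rfl⟩; exact S.measurable_logDiff hf hf₀ k)
    (by rintro _ ⟨f, hf, -, rfl⟩; exact S.abs_logDiff_le hf hf₀ k)
    (by rintro _ ⟨f, hf, h, rfl⟩; exact h) (mul_pos hn hρ) hc one_pos hl hl1 h0 hM hcov
    (fun R => by
      refine le_trans (le_of_eq ?_) (mul_le_mul_of_nonneg_left (hsum R) hn.le)
      rw [Finset.mul_sum]
      exact Finset.sum_congr rfl fun r _ => by ring)
  refine ⟨W, hW, hWi, hWE, fun f hf hle ω => (hb _ ⟨f, hf, hle, rfl⟩ ω).trans ?_⟩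
  have h1 : h 0 ≤ 2 * (φ ρ / ρ) := by
    have := hsum 1
    simp only [Finset.sum_range_one, pow_zero, div_one] at this
    rw [← mul_div_assoc, le_div_iff₀ hρ]
    linarith
  have h2 : (h 0 ^ 2 + c ^ 2) / lm ≤ ((2 * (φ ρ / ρ)) ^ 2 + c ^ 2) / lm := by
    refine div_le_div_of_nonneg_right ?_ hl.le
    linarith [pow_le_pow_left₀ (h0 0) h1 2]
  linarith

theorem le_one_of_log_lt {M : ℕ} (h : Real.log M < Real.log 2) : M ≤ 1 := by
  by_contra hc
  have h2 : (2 : ℝ) ≤ M := by exact_mod_cast (by omega : 2 ≤ M)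
  exact absurd (Real.log_le_log two_pos h2) (not_le.2 h)

/-- With small complexity the whole model lies in one ball around any of its elements. -/
theorem Setting.sqSize_le_of_small (S : Setting P lam s X F τ)
    (hE : EntropyIntegralBound lam N s F φ) {f f₀ : Fin K → 𝒳 → ℝ} (hf : f ∈ F) (hf₀ : f₀ ∈ F)
    (k : Fin L → Fin K) {σ T : ℝ} (hσ : 0 < σ) (hT : T < 1 / 32)
    (hφ : ∀ ρ, σ ≤ ρ → φ ρ ≤ ρ * Real.sqrt T) :
    sqSize P X (logDiff k f f₀) ≤ ENNReal.ofReal ((Real.sqrt (total N) * σ) ^ 2) := by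
  have hn : 0 < Real.sqrt (total N) := Real.sqrt_pos.2 (by exact_mod_cast S.total_pos)
  have hfin : sqSize P X (logDiff k f f₀) ≠ ∞ :=
    ne_top_of_le_ne_top ENNReal.ofReal_ne_top (S.sqSize_logDiff_le_card hf hf₀ k)
  by_contra hc
  push Not at hc
  set w := Real.sqrt (sqSize P X (logDiff k f f₀)).toReal with hw
  have hw2 : sqSize P X (logDiff k f f₀) = ENNReal.ofReal (w ^ 2) := by
    rw [hw, Real.sq_sqrt ENNReal.toReal_nonneg, ENNReal.ofReal_toReal hfin]
  have hwσ : Real.sqrt (total N) * σ < w := by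
    rw [hw2] at hc
    exact lt_of_pow_lt_pow_left₀ 2 (Real.sqrt_nonneg _)
      (ENNReal.ofReal_lt_ofReal_iff_of_nonneg (sq_nonneg _) |>.1 hc)
  have hw0 : 0 < w := (mul_pos hn hσ).trans hwσ
  set d := w / Real.sqrt (total N) with hd
  have hdw : Real.sqrt (total N) * d = w := by rw [hd]; field_simp
  have hdσ : σ ≤ d := by rw [hd, le_div_iff₀ hn]; linarith
  have hd0 : 0 < d := hσ.trans_le hdσ
  -- The ball has radius exactly the distance from `f` to `f₀`, which is above σ. At half that scale
  -- the root entropy is at most 4√T, below √(log 2), so one bracket contains both functions and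
  -- their distance would be at most half of itself.
  obtain ⟨M, h, h0, hlog, -, hcov, hsum⟩ := S.exists_logBall_covers hE hf₀ k hd0
  have h1 : h 1 ≤ 4 * Real.sqrt T := by
    have h2 := hsum 2
    simp only [Finset.sum_range_succ, Finset.sum_range_zero, pow_zero, pow_one, div_one,
      zero_add] at h2
    have h3 := hφ d hdσ
    have h4 := mul_nonneg hd0.le (h0 0)
    have h5 : d * h 1 ≤ d * (4 * Real.sqrt T) := by nlinarith
    exact le_of_mul_le_mul_left h5 hd0
  have hM : M 1 ≤ 1 := by
    refine le_one_of_log_lt ?_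
    rw [hlog]
    have h2 := pow_le_pow_left₀ (h0 1) h1 2
    have h3 : Real.sqrt T ^ 2 ≤ 1 / 32 := by
      rcases le_total 0 T with h | h
      · rw [Real.sq_sqrt h]; exact hT.le
      · rw [Real.sqrt_eq_zero_of_nonpos h]; norm_num
    have := Real.log_two_gt_d9
    nlinarith
  obtain ⟨a, b, -, hsz, hmem⟩ := hcov 1
  rw [hdw] at hmem hsz
  have hss : Subsingleton (Fin (M 1)) := Fin.subsingleton_iff_le_one.2 hM
  obtain ⟨i, hi⟩ := hmem _ ⟨f, hf, hw2.le, rfl⟩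
  obtain ⟨j, hj⟩ := hmem _ ⟨f₀, hf₀, by simp [sqSize, logDiff], rfl⟩
  obtain rfl := Subsingleton.elim i j
  have hle : sqSize P X (logDiff k f f₀) ≤ ENNReal.ofReal ((w / 2 ^ 1) ^ 2) := by
    refine le_trans ?_ (hsz i)
    refine Finset.sum_le_sum fun q _ => lintegral_mono fun ω => ENNReal.ofReal_le_ofReal ?_
    obtain ⟨h2, h3⟩ := hi q (X q ω)
    obtain ⟨h4, h5⟩ := hj q (X q ω)
    have h6 : logDiff k f₀ f₀ q (X q ω) = 0 := sub_self _
    rw [h6] at h4 h5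
    exact sq_le_sq' (by linarith) (by linarith)
  rw [hw2, ENNReal.ofReal_le_ofReal_iff (sq_nonneg _)] at hle
  nlinarith

/-- With small complexity the centered sums are bounded in expectation by a universal constant,
uniformly over the model. -/
theorem Setting.exists_small_bound (S : Setting P lam s X F τ)
    (hE : EntropyIntegralBound lam N s F φ) {f₀ : Fin K → 𝒳 → ℝ} (hf₀ : f₀ ∈ F)
    (k : Fin L → Fin K) {σ T : ℝ} (hσ : 0 < σ) (hTσ : T = total N * σ ^ 2) (hT : T < 1 / 32)
    (hφ : ∀ ρ, σ ≤ ρ → φ ρ ≤ ρ * Real.sqrt T) :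
    ∃ W : Ω → ℝ, Integrable W P ∧ ∫ ω, W ω ∂P ≤ 2 ∧
      ∀ f ∈ F, ∀ ω, centeredSum P X (logDiff k f f₀) ω ≤ 10 + W ω := by
  have hn : 0 < Real.sqrt (total N) := Real.sqrt_pos.2 (by exact_mod_cast S.total_pos)
  obtain ⟨M, h, h0, hlog, hM, hcov, hsum⟩ := S.exists_logBall_covers hE hf₀ k hσ
  have hT0 : 0 ≤ T := by rw [hTσ]; positivity
  have hv : Real.sqrt (total N) * σ = Real.sqrt T := by
    rw [hTσ, Real.sqrt_mul (Nat.cast_nonneg _), Real.sqrt_sq hσ.le]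
  have hsT : Real.sqrt T ^ 2 = T := Real.sq_sqrt hT0
  have hsT1 : Real.sqrt T ≤ 1 :=
    Real.sqrt_le_iff.2 ⟨zero_le_one, by linarith⟩
  have hφσ := hφ σ le_rfl
  have hM0 : M 0 ≤ 1 := by
    refine le_one_of_log_lt ?_
    rw [hlog]
    have h2 := hsum 1
    simp only [Finset.sum_range_one, pow_zero, div_one] at h2
    have h3 : σ * h 0 ≤ σ * (2 * Real.sqrt T) := by nlinarith
    have h4 := pow_le_pow_left₀ (h0 0) (le_of_mul_le_mul_left h3 hσ) 2
    have := Real.log_two_gt_d9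
    nlinarith
  obtain ⟨W, hWi, hWE, hb⟩ := exists_single_bracket_bound (τ := τ)
    (Ψ := Real.sqrt (total N) * (2 * φ σ)) S.aemeasurable S.indep S.tau_nonneg
    (by rintro _ ⟨f, hf, -, rfl⟩; exact S.measurable_logDiff hf hf₀ k)
    (by rintro _ ⟨f, hf, -, rfl⟩; exact S.abs_logDiff_le hf hf₀ k)
    (by rintro _ ⟨f, hf, h, rfl⟩; exact h) (mul_pos hn hσ) one_pos h0 hM hM0 hcov
    (fun R => by
      refine le_trans (le_of_eq ?_) (mul_le_mul_of_nonneg_left (hsum R) hn.le)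
      rw [Finset.mul_sum]
      exact Finset.sum_congr rfl fun r _ => by ring)
  refine ⟨W, hWi, ?_, fun f hf ω => ?_⟩
  · rw [hv] at hWE; linarith
  · have h1 := hb _ ⟨f, hf, S.sqSize_le_of_small hE hf hf₀ k hσ hT hφ, rfl⟩ ω
    have h2 : Real.sqrt (total N) * φ σ ≤ T := by
      calc _ ≤ Real.sqrt (total N) * (σ * Real.sqrt T) := mul_le_mul_of_nonneg_left hφσ hn.le
        _ = T := by rw [← mul_assoc, hv, ← sq, hsT]
    rw [hv] at h1
    linarith

end Peeling

/-! ### Peeling over dyadic shells and its constants -/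

section Shells

/-- The slope allowed to the quadratic term in the shell bound. -/
noncomputable def shellSlope (θ τ : ℝ) : ℝ := θ * Real.exp (-τ) / 32

/-- The exponential parameter of the initial step of the chaining. -/
noncomputable def shellParam (θ τ : ℝ) : ℝ := shellSlope θ τ * Real.exp (-τ) / 16

/-- The constant of the shell bound. -/
noncomputable def shellConst (θ τ : ℝ) : ℝ :=
  4 / shellParam θ τ + (4 / shellParam θ τ + 12 + 36 / shellSlope θ τ) ^ 2 / shellSlope θ τ +
    shellSlope θ τ + 1

theorem shellSlope_pos {θ : ℝ} (hθ : 0 < θ) (τ : ℝ) : 0 < shellSlope θ τ := by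
  unfold shellSlope; positivity

theorem shellParam_pos {θ : ℝ} (hθ : 0 < θ) (τ : ℝ) : 0 < shellParam θ τ := by
  have := shellSlope_pos hθ τ
  unfold shellParam; positivity

theorem shellConst_pos {θ : ℝ} (hθ : 0 < θ) (τ : ℝ) : 0 < shellConst θ τ := by
  have := shellSlope_pos hθ τ
  have := shellParam_pos hθ τ
  unfold shellConst; positivity

theorem shellParam_le_one {θ τ : ℝ} (hθ1 : θ ≤ 1) (hτ : 0 ≤ τ) :
    shellParam θ τ ≤ 1 := by
  have h1 : Real.exp (-τ) ≤ 1 := Real.exp_le_one_iff.2 (by linarith)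
  have h2 := Real.exp_pos (-τ)
  unfold shellParam shellSlope
  nlinarith [mul_le_mul_of_nonneg_right hθ1 (mul_pos h2 h2).le, mul_le_mul_of_nonneg_left h1 h2.le]

/-- All terms of order below two in the radius are absorbed by the quadratic one. -/
theorem shell_polynomial_le {θ τ y : ℝ} (hθ : 0 < θ) (hy : 0 ≤ y) :
    4 * shellParam θ τ * Real.exp τ * y ^ 2 + (4 + 4 * y) / shellParam θ τ +
      6 * (y * Real.sqrt y) + 12 * y + shellSlope θ τ + 1 ≤
        shellSlope θ τ * y ^ 2 + shellConst θ τ := by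
  have h0 := shellSlope_pos hθ τ
  have hp := shellParam_pos hθ τ
  -- `shellParam` is chosen so that the variance term uses a quarter of the allowed slope. The
  -- y^(3/2) and linear terms each take another quarter, by completing squares.
  have h1 : 4 * shellParam θ τ * Real.exp τ = shellSlope θ τ / 4 := by
    have : Real.exp (-τ) * Real.exp τ = 1 := by rw [← Real.exp_add]; simp
    unfold shellParam
    linear_combination (shellSlope θ τ / 4) * this
  set a := shellSlope θ τ with ha
  set p := shellParam θ τ with hp'
  obtain ⟨w, hw⟩ : ∃ w, w = Real.sqrt y := ⟨_, rfl⟩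
  have hw2 : w ^ 2 = y := by rw [hw, Real.sq_sqrt hy]
  have h2 : 6 * (y * Real.sqrt y) ≤ a / 4 * y ^ 2 + 36 / a * y := by
    rw [← hw, ← hw2]
    have e : a / 4 * (w ^ 2) ^ 2 + 36 / a * w ^ 2 - 6 * (w ^ 2 * w) =
        w ^ 2 * (a * w / 2 - 6) ^ 2 / a := by field_simp; ring
    have : 0 ≤ w ^ 2 * (a * w / 2 - 6) ^ 2 / a := by positivity
    linarith
  have h3 : (4 / p + 12 + 36 / a) * y ≤ a / 4 * y ^ 2 + (4 / p + 12 + 36 / a) ^ 2 / a := by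
    set β := 4 / p + 12 + 36 / a
    have e : a / 4 * y ^ 2 + β ^ 2 / a - β * y = (a * y / 2 - β) ^ 2 / a := by field_simp; ring
    have : 0 ≤ (a * y / 2 - β) ^ 2 / a := by positivity
    linarith
  have h4 : (4 + 4 * y) / p = 4 / p + 4 / p * y := by ring
  rw [h1, h4]
  have h5 : shellConst θ τ = 4 / p + (4 / p + 12 + 36 / a) ^ 2 / a + a + 1 := rfl
  rw [h5]
  have h6 : 0 ≤ a * y ^ 2 := by positivity
  nlinarith

/-- Of exp(-3yT), with y = 2^j, one factor exp(-y) absorbs the growth of the radius and exp(-2y)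
provides the summable 2^-(j+1). -/
theorem exp_mul_add_le {j : ℕ} {T b : ℝ} (hT : 1 ≤ T) (hb : 0 ≤ b) :
    Real.exp (-(3 * (2 ^ j * T))) * (b + 2 * (2 ^ j * Real.sqrt T)) ≤
      (1 / 2) ^ (j + 1) * ((b + 2) * T) := by
  set y : ℝ := 2 ^ j with hy
  have hy1 : 1 ≤ y := one_le_pow₀ one_le_two
  have hsT : Real.sqrt T ≤ T := by
    rw [Real.sqrt_le_left (by linarith)]; nlinarith
  have h1 : b + 2 * (y * Real.sqrt T) ≤ y * ((b + 2) * T) := by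
    have h2 : b ≤ y * (b * T) := by
      have : b * 1 ≤ b * (y * T) := mul_le_mul_of_nonneg_left (by nlinarith) hb
      linarith
    have h3 : y * Real.sqrt T ≤ y * T := mul_le_mul_of_nonneg_left hsT (by linarith)
    linarith
  have h4 : Real.exp (-(3 * (y * T))) * y ≤ (1 / 2) ^ (j + 1) := by
    have h5 : Real.exp (-(3 * (y * T))) ≤ Real.exp (-y) * Real.exp (-(2 * y)) := by
      rw [← Real.exp_add]; exact Real.exp_le_exp.2 (by nlinarith)
    have h6 : y * Real.exp (-y) ≤ 1 := by
      have h7 : y ≤ Real.exp y := by have := Real.add_one_le_exp y; linarith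
      calc y * Real.exp (-y) ≤ Real.exp y * Real.exp (-y) := by gcongr
        _ = 1 := by rw [← Real.exp_add]; simp
    have h8 : Real.exp (-(2 * y)) ≤ (1 / 2) ^ (j + 1) := by
      rw [Real.exp_neg, one_div, inv_pow]
      refine inv_anti₀ (by positivity) ?_
      have := Real.add_one_le_exp (2 * y)
      rw [pow_succ, ← hy]
      linarith
    calc Real.exp (-(3 * (y * T))) * y ≤ (Real.exp (-y) * Real.exp (-(2 * y))) * y := by gcongr
      _ = (y * Real.exp (-y)) * Real.exp (-(2 * y)) := by ring
      _ ≤ 1 * Real.exp (-(2 * y)) := by gcongr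
      _ ≤ _ := by rw [one_mul]; exact h8
  calc _ ≤ Real.exp (-(3 * (y * T))) * (y * ((b + 2) * T)) := by gcongr
    _ = (Real.exp (-(3 * (y * T))) * y) * ((b + 2) * T) := by ring
    _ ≤ _ := by
      have : 0 ≤ (b + 2) * T := by nlinarith
      exact mul_le_mul_of_nonneg_right h4 this

theorem sum_half_pow_le (J : ℕ) : ∑ j ∈ Finset.range J, (1 / 2 : ℝ) ^ (j + 1) ≤ 1 := by
  have : ∑ j ∈ Finset.range J, (1 / 2 : ℝ) ^ (j + 1) = 1 - (1 / 2) ^ J := by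
    induction J with
    | zero => simp
    | succ J ih => rw [Finset.sum_range_succ, ih, pow_succ]; ring
  rw [this]
  have : (0 : ℝ) < (1 / 2) ^ J := by positivity
  linarith

variable {Ω 𝒳 : Type*} [MeasurableSpace Ω] [MeasurableSpace 𝒳] {P : Measure Ω}
  [IsProbabilityMeasure P]
  {lam : Measure 𝒳} {K L : ℕ} {N : Fin L → ℕ} {s : Fin L → 𝒳 → ℝ}
  {X : ((l : Fin L) × Fin (N l)) → Ω → 𝒳} {F : Set (Fin K → 𝒳 → ℝ)} {τ : ℝ} {φ : ℝ → ℝ}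

/-- Peeling: the centered log-ratios are bounded by a small multiple of the Kullback-Leibler
losses, uniformly over the model and the assignments. -/
theorem Setting.exists_peeling_bound (S : Setting P lam s X F τ)
    (hE : EntropyIntegralBound lam N s F φ) (hK : 0 < K)
    {f₀ : (Fin L → Fin K) → Fin K → 𝒳 → ℝ} (hf₀ : ∀ k, f₀ k ∈ F) {T θ : ℝ} (hT : 1 ≤ T)
    (hLK : L * Real.log K ≤ T) (hθ : 0 < θ) (hθ1 : θ ≤ 1)
    (hφ : ∀ ρ, 0 < ρ → T ≤ total N * ρ ^ 2 → φ ρ ≤ ρ * Real.sqrt T) :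
    ∃ W : Ω → ℝ, (∀ ω, 0 ≤ W ω) ∧ Integrable W P ∧
      ∫ ω, W ω ∂P ≤ (1 / shellParam θ τ + 2) * T ∧
      ∀ k, ∀ f ∈ F, ∀ ω, centeredSum P X (logDiff k f (f₀ k)) ω ≤
        θ * (klSum P X s f k + klSum P X s (f₀ k) k) + shellConst θ τ * T + W ω := by
  have hn : 0 < Real.sqrt (total N) := Real.sqrt_pos.2 (by exact_mod_cast S.total_pos)
  have hn2 : Real.sqrt (total N) ^ 2 = total N := Real.sq_sqrt (Nat.cast_nonneg _)
  have hT0 : 0 < T := by linarith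
  have hsT : 0 < Real.sqrt T := Real.sqrt_pos.2 hT0
  have hsT2 : Real.sqrt T ^ 2 = T := Real.sq_sqrt hT0.le
  have hKr : (0 : ℝ) < K := by exact_mod_cast hK
  have hl := shellParam_pos hθ τ
  have hl1 := shellParam_le_one hθ1 S.tau_nonneg
  have hsl := shellSlope_pos hθ τ
  set lm := shellParam θ τ with hlm
  let ρ : ℕ → ℝ := fun j => 2 ^ j * Real.sqrt T / Real.sqrt (total N)
  have hρ : ∀ j, 0 < ρ j := fun j => by positivity
  have hnρ : ∀ j, Real.sqrt (total N) * ρ j = 2 ^ j * Real.sqrt T := fun j => by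
    simp only [ρ]; field_simp
  have hy1 : ∀ j : ℕ, (1 : ℝ) ≤ 2 ^ j := fun j => one_le_pow₀ one_le_two
  have hφρ : ∀ j, φ (ρ j) ≤ ρ j * Real.sqrt T := fun j => by
    refine hφ _ (hρ j) ?_
    rw [← hn2, ← mul_pow, hnρ, mul_pow, hsT2]
    exact le_mul_of_one_le_left hT0.le (one_le_pow₀ (hy1 j))
  -- In c² = 4 · 2^j T one part pays for the K^L assignments, since L log K ≤ T, and three make the
  -- shells summable. As `c` grows only like 2^(j/2), the product of radius and `c` stays of lower
  -- order than 4^j.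
  let c : ℕ → ℝ := fun j => Real.sqrt (4 * (2 ^ j * T))
  have hc2 : ∀ j, c j ^ 2 = 4 * (2 ^ j * T) := fun j => Real.sq_sqrt (by positivity)
  have hc1 : ∀ j, 1 ≤ c j := fun j => by
    refine Real.le_sqrt_of_sq_le ?_
    nlinarith [hy1 j]
  have hcs : ∀ j, c j = 2 * Real.sqrt (2 ^ j) * Real.sqrt T := fun j => by
    simp only [c]
    rw [← mul_assoc, Real.sqrt_mul (by positivity), Real.sqrt_mul (by norm_num)]
    congr 2
    rw [show (4 : ℝ) = 2 ^ 2 by norm_num, Real.sqrt_sq (by norm_num)]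
  choose W hW hWi hWE hb using fun (k : Fin L → Fin K) (j : ℕ) =>
    S.exists_logBall_bound hE (hf₀ k) k (hρ j) (hc1 j) hl hl1
  -- Log-ratios are bounded by `τ`, so the squared radius never exceeds n τ² and finitely many
  -- shells suffice.
  obtain ⟨J, hJ⟩ : ∃ J : ℕ, total N * τ ^ 2 < 2 ^ J := pow_unbounded_of_one_lt _ one_lt_two
  have hint : ∀ k, Integrable (fun ω => ∑ j ∈ Finset.range (J + 1), W k j ω) P := fun k =>
    integrable_finsetSum _ fun j _ => hWi k j
  refine ⟨fun ω => ∑ k, ∑ j ∈ Finset.range (J + 1), W k j ω,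
    fun ω => Finset.sum_nonneg fun k _ => Finset.sum_nonneg fun j _ => hW k j ω,
    integrable_finsetSum _ fun k _ => hint k, ?_, fun k f hf ω => ?_⟩
  · rw [integral_finsetSum _ fun k _ => hint k]
    have hk : ∀ k, ∫ ω, ∑ j ∈ Finset.range (J + 1), W k j ω ∂P ≤
        ((K : ℝ) ^ L)⁻¹ * ((1 / lm + 2) * T) := fun k => by
      rw [integral_finsetSum _ fun j _ => hWi k j]
      calc ∑ j ∈ Finset.range (J + 1), ∫ ω, W k j ω ∂P
          ≤ ∑ j ∈ Finset.range (J + 1),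
              (1 / 2 : ℝ) ^ (j + 1) * (((K : ℝ) ^ L)⁻¹ * ((1 / lm + 2) * T)) := by
            refine Finset.sum_le_sum fun j _ => (hWE k j).trans ?_
            rw [hc2, hnρ]
            have h1 : Real.exp (-(4 * (2 ^ j * T))) ≤
                ((K : ℝ) ^ L)⁻¹ * Real.exp (-(3 * (2 ^ j * T))) := by
              have h2 : ((K : ℝ) ^ L)⁻¹ = Real.exp (-(L * Real.log K)) := by
                rw [Real.exp_neg, ← Real.log_pow, Real.exp_log (by positivity)]
              rw [h2, ← Real.exp_add]
              exact Real.exp_le_exp.2 (by nlinarith [hy1 j])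
            have h3 := exp_mul_add_le (j := j) hT (one_div_pos.2 hl).le
            calc _ ≤ ((K : ℝ) ^ L)⁻¹ * Real.exp (-(3 * (2 ^ j * T))) *
                  (1 / lm + 2 * (2 ^ j * Real.sqrt T)) := by gcongr
              _ = ((K : ℝ) ^ L)⁻¹ * (Real.exp (-(3 * (2 ^ j * T))) *
                  (1 / lm + 2 * (2 ^ j * Real.sqrt T))) := by ring
              _ ≤ ((K : ℝ) ^ L)⁻¹ * ((1 / 2) ^ (j + 1) * ((1 / lm + 2) * T)) := by gcongr
              _ = _ := by ring
        _ ≤ 1 * (((K : ℝ) ^ L)⁻¹ * ((1 / lm + 2) * T)) := by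
            rw [← Finset.sum_mul]
            exact mul_le_mul_of_nonneg_right (sum_half_pow_le _) (by positivity)
        _ = _ := one_mul _
    calc _ ≤ ∑ _k : Fin L → Fin K, ((K : ℝ) ^ L)⁻¹ * ((1 / lm + 2) * T) :=
          Finset.sum_le_sum fun k _ => hk k
      _ = (1 / lm + 2) * T := by
          rw [Finset.sum_const, Finset.card_univ, nsmul_eq_mul]
          simp only [Fintype.card_fun, Fintype.card_fin, Nat.cast_pow]
          rw [← mul_assoc, mul_inv_cancel₀ (by positivity), one_mul]
  · have hJle : sqSize P X (logDiff k f (f₀ k)) ≤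
        ENNReal.ofReal ((Real.sqrt (total N) * ρ J) ^ 2) := by
      refine (S.sqSize_logDiff_le_card hf (hf₀ k) k).trans (ENNReal.ofReal_le_ofReal ?_)
      rw [hnρ, mul_pow, hsT2]
      nlinarith [hy1 J]
    have hex : ∃ j, sqSize P X (logDiff k f (f₀ k)) ≤
        ENNReal.ofReal ((Real.sqrt (total N) * ρ j) ^ 2) := ⟨J, hJle⟩
    classical
    obtain ⟨j, hjle, hjs, hjmin⟩ : ∃ j ≤ J, sqSize P X (logDiff k f (f₀ k)) ≤
        ENNReal.ofReal ((Real.sqrt (total N) * ρ j) ^ 2) ∧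
        ∀ i < j, ¬ sqSize P X (logDiff k f (f₀ k)) ≤
          ENNReal.ofReal ((Real.sqrt (total N) * ρ i) ^ 2) :=
      ⟨Nat.find hex, Nat.find_min' hex hJle, Nat.find_spec hex, fun i hi => Nat.find_min hex hi⟩
    have hD1 := S.klSum_nonneg hf k
    have hD2 := S.klSum_nonneg (hf₀ k) k
    set D := klSum P X s f k + klSum P X s (f₀ k) k with hD
    have hD0 : 0 ≤ D := by linarith
    -- Beyond the innermost shell, minimality of `j` bounds the squared radius by four times the
    -- squared size, hence by 4 · 8 exp τ times the losses. The factor 32 is the one in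
    -- `shellSlope`.
    have hyT : (2 ^ j : ℝ) ^ 2 * T ≤ 32 * Real.exp τ * D + T := by
      rcases Nat.eq_zero_or_pos j with h0 | h0
      · rw [h0]
        have : 0 ≤ 32 * Real.exp τ * D := by positivity
        linarith
      · obtain ⟨i, rfl⟩ : ∃ i, j = i + 1 := ⟨j - 1, by omega⟩
        have h1 := (lt_of_not_ge (hjmin i (Nat.lt_succ_self i))).trans_le
          (S.sqSize_logDiff_le hf (hf₀ k) k)
        rw [ENNReal.ofReal_lt_ofReal_iff_of_nonneg (sq_nonneg _), hnρ, mul_pow, hsT2, ← hD] at h1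
        have h2 : (2 ^ (i + 1) : ℝ) ^ 2 * T = 4 * ((2 ^ i) ^ 2 * T) := by rw [pow_succ (2 : ℝ) i]; ring
        linarith
    have hWk : W k j ω ≤ ∑ k, ∑ j ∈ Finset.range (J + 1), W k j ω :=
      (Finset.single_le_sum (f := fun j => W k j ω) (fun i _ => hW k i ω)
        (Finset.mem_range.2 (Nat.lt_succ_of_le hjle))).trans
        (Finset.single_le_sum (f := fun k => ∑ j ∈ Finset.range (J + 1), W k j ω)
          (fun i _ => Finset.sum_nonneg fun j _ => hW i j ω) (Finset.mem_univ k))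
    have hmain := hb k j f hf hjs ω
    have hp := shell_polynomial_le (τ := τ) (y := 2 ^ j) hθ (by positivity)
    rw [← hlm] at hp
    have e1 : (2 * (φ (ρ j) / ρ j)) ^ 2 ≤ 4 * T := by
      have h1 : φ (ρ j) / ρ j ≤ Real.sqrt T := by
        rw [div_le_iff₀ (hρ j), mul_comm]; exact hφρ j
      have h2 : 0 ≤ φ (ρ j) / ρ j := div_nonneg (hE.nonneg _ (hρ j).le) (hρ j).le
      calc _ = 4 * (φ (ρ j) / ρ j) ^ 2 := by ring
        _ ≤ 4 * Real.sqrt T ^ 2 := by gcongr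
        _ = _ := by rw [hsT2]
    have e2 : Real.sqrt (total N) * φ (ρ j) ≤ 2 ^ j * T := by
      calc _ ≤ Real.sqrt (total N) * (ρ j * Real.sqrt T) :=
            mul_le_mul_of_nonneg_left (hφρ j) hn.le
        _ = _ := by rw [← mul_assoc, hnρ, mul_assoc, ← sq, hsT2]
    have e3 : 3 * (Real.sqrt (total N) * ρ j) * c j = 6 * (2 ^ j * Real.sqrt (2 ^ j)) * T := by
      rw [hnρ, hcs]; linear_combination (6 * 2 ^ j * Real.sqrt (2 ^ j)) * hsT2
    have e4 : (Real.sqrt (total N) * ρ j) ^ 2 = (2 ^ j) ^ 2 * T := by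
      rw [hnρ, mul_pow, hsT2]
    have e5 : ((2 * (φ (ρ j) / ρ j)) ^ 2 + c j ^ 2) / lm ≤ (4 + 4 * 2 ^ j) / lm * T := by
      rw [hc2, div_mul_eq_mul_div]
      refine div_le_div_of_nonneg_right ?_ hl.le
      linarith
    rw [e3, e4] at hmain
    have hp2 := mul_le_mul_of_nonneg_right hp hT0.le
    have e6 : shellSlope θ τ * ((2 ^ j : ℝ) ^ 2 * T) ≤ θ * D + shellSlope θ τ * T := by
      refine (mul_le_mul_of_nonneg_left hyT hsl.le).trans (le_of_eq ?_)
      have : Real.exp (-τ) * Real.exp τ = 1 := by rw [← Real.exp_add]; simp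
      unfold shellSlope
      linear_combination (θ * D) * this
    linarith

end Shells

/-! ### From the likelihood inequality to the oracle inequality -/

section Risk

variable {Ω 𝒳 : Type*} [MeasurableSpace Ω] [MeasurableSpace 𝒳] {P : Measure Ω}
  {lam : Measure 𝒳} {K L : ℕ} {N : Fin L → ℕ} {s : Fin L → 𝒳 → ℝ}
  {X : ((l : Fin L) × Fin (N l)) → Ω → 𝒳} {F : Set (Fin K → 𝒳 → ℝ)} {τ : ℝ} {φ : ℝ → ℝ}

/-- The loss of an approximate minimizer is controlled by the centered log-likelihoods. -/
theorem Setting.klSum_le_of_isEtaMinimizer (S : Setting P lam s X F τ) {η : ℝ} {p : Fin K → ℝ}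
    {f g : Fin K → 𝒳 → ℝ} {k k' : Fin L → Fin K} {ω : Ω}
    (hmin : IsEtaMinimizer (fun l i => X ⟨l, i⟩ ω) F η p f)
    (hmap : IsMAP (fun l i => X ⟨l, i⟩ ω) p f k) (hg : g ∈ F) :
    klSum P X s f k ≤ klSum P X s g k' + centeredSum P X (logLik s k f) ω -
      centeredSum P X (logLik s k' g) ω + 2 * (L * Real.log K) + η := by
  have h1 := sum_log_le_of_isEtaMinimizer (k' := k') (fun f hf k x => S.pos hf k x) hmin hmap hg
  have h2 : ∀ (h : Fin K → 𝒳 → ℝ) (k : Fin L → Fin K), centeredSum P X (logLik s k h) ω =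
      ∑ l, ∑ i, Real.log (h (k l) (X ⟨l, i⟩ ω)) - ∑ q, Real.log (s q.1 (X q ω)) +
        klSum P X s h k := fun h k => by
    rw [← Fintype.sum_sigma' (fun l i => Real.log (h (k l) (X ⟨l, i⟩ ω))),
      ← Finset.sum_sub_distrib, centeredSum, Finset.sum_sub_distrib, klSum]
    simp only [logLik]
    ring
  rw [h2, h2]
  linarith

variable [IsProbabilityMeasure P]

theorem Setting.lintegral_weightedKL_le (S : Setting P lam s X F τ) {f : Ω → Fin K → 𝒳 → ℝ}
    {k : Ω → Fin L → Fin K} {R : Ω → ℝ} {B : ℝ} (hR : Integrable R P)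
    (h : ∀ᵐ ω ∂P, f ω ∈ F ∧ klSum P X s (f ω) (k ω) ≤ R ω) (hB : ∫ ω, R ω ∂P ≤ B) :
    ∫⁻ ω, weightedKL lam N s (f ω) (k ω) ∂P ≤ ENNReal.ofReal (B / total N) := by
  have hn : (0 : ℝ) < total N := by exact_mod_cast S.total_pos
  calc _ ≤ ∫⁻ ω, ENNReal.ofReal (R ω / total N) ∂P := by
        refine lintegral_mono_ae ?_
        filter_upwards [h] with ω hω
        rw [S.weightedKL_eq hω.1]
        exact ENNReal.ofReal_le_ofReal (div_le_div_of_nonneg_right hω.2 hn.le)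
    _ = ENNReal.ofReal (∫ ω, R ω / total N ∂P) := by
        refine (ofReal_integral_eq_lintegral_ofReal (hR.div_const _) ?_).symm
        filter_upwards [h] with ω hω
        exact div_nonneg ((S.klSum_nonneg hω.1 _).trans hω.2) hn.le
    _ ≤ _ := by
        rw [integral_div]
        exact ENNReal.ofReal_le_ofReal (div_le_div_of_nonneg_right hB hn.le)

theorem Setting.exists_near_minimizer (S : Setting P lam s X F τ) (hF : F.Nonempty) {T : ℝ}
    (hT : 0 < T) (k : Fin L → Fin K) :
    ∃ f₀ ∈ F, ∀ f ∈ F, klSum P X s f₀ k ≤ klSum P X s f k + T := by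
  have hne : ((fun f => klSum P X s f k) '' F).Nonempty := hF.image _
  have hbd : BddBelow ((fun f => klSum P X s f k) '' F) :=
    ⟨0, by rintro _ ⟨f, hf, rfl⟩; exact S.klSum_nonneg hf k⟩
  obtain ⟨_, ⟨f₀, hf₀, rfl⟩, hlt⟩ := exists_lt_of_csInf_lt hne
    (lt_add_of_pos_right (sInf ((fun f => klSum P X s f k) '' F)) hT)
  exact ⟨f₀, hf₀, fun f hf => hlt.le.trans
    (add_le_add_left (csInf_le hbd ⟨f, hf, rfl⟩) T)⟩

/-- The complexity constant of the risk bound, for the proportion `θ` of the loss that is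
absorbed. -/
noncomputable def riskConst (θ τ : ℝ) : ℝ :=
  32 * (2 + shellConst θ τ + (1 / shellParam θ τ + 2) + 2 * Real.exp τ / θ) + 2 * Real.exp τ / θ

theorem riskConst_pos {θ : ℝ} (hθ : 0 < θ) (τ : ℝ) : 0 < riskConst θ τ := by
  have := shellConst_pos hθ τ
  have := shellParam_pos hθ τ
  unfold riskConst; positivity

/-- Oracle inequality when the complexity is not small. -/
theorem Setting.exists_risk_bound_of_large (S : Setting P lam s X F τ)
    (hE : EntropyIntegralBound lam N s F φ) (hK : 0 < K) {T θ η : ℝ} (hT : 1 ≤ T)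
    (hLK : L * Real.log K ≤ T) (hθ : 0 < θ) (hθ1 : θ ≤ 1)
    (hφ : ∀ ρ, 0 < ρ → T ≤ total N * ρ ^ 2 → φ ρ ≤ ρ * Real.sqrt T)
    {pHat : Ω → Fin K → ℝ} {fHat : Ω → Fin K → 𝒳 → ℝ} {kHat : Ω → Fin L → Fin K}
    (hmin : ∀ᵐ ω ∂P, IsEtaMinimizer (fun l i => X ⟨l, i⟩ ω) F η (pHat ω) (fHat ω))
    (hmap : ∀ᵐ ω ∂P, IsMAP (fun l i => X ⟨l, i⟩ ω) (pHat ω) (fHat ω) (kHat ω))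
    {g : Fin K → 𝒳 → ℝ} (hg : g ∈ F) (k' : Fin L → Fin K) :
    ∃ R : Ω → ℝ, Integrable R P ∧
      (∀ᵐ ω ∂P, fHat ω ∈ F ∧ (1 - 3 * θ) * klSum P X s (fHat ω) (kHat ω) ≤ R ω) ∧
      ∫ ω, R ω ∂P ≤ klSum P X s g k' + (2 + 2 * Real.exp τ / θ) * (L * Real.log K) + η +
        (1 + shellConst θ τ + (1 / shellParam θ τ + 2) + 2 * Real.exp τ / θ) * T +
        θ * T := by
  -- The infimum of the loss need not be attained; slack `T` is affordable. Near minimality allows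
  -- the loss at the anchor to be replaced by that of the estimator.
  choose f₀ hf₀ hnear using S.exists_near_minimizer (T := T) ⟨g, hg⟩ (by linarith)
  have hexp : 1 ≤ Real.exp τ := Real.one_le_exp S.tau_nonneg
  have hexp0 := Real.exp_pos τ
  -- This parameter makes the coefficient 2 lm exp τ of the anchor loss equal to θ.
  have hl : 0 < θ / (2 * Real.exp τ) := by positivity
  have hl1 : θ / (2 * Real.exp τ) ≤ 1 := by rw [div_le_one (by positivity)]; linarith
  obtain ⟨W₁, -, hWi₁, hWE₁, hb₁⟩ := S.exists_assignment_bound hK hf₀ hl hl1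
  obtain ⟨W₂, -, hWi₂, hWE₂, hb₂⟩ := S.exists_peeling_bound hE hK hf₀ hT hLK hθ hθ1 hφ
  have hinv : 1 / (θ / (2 * Real.exp τ)) = 2 * Real.exp τ / θ := by field_simp
  have hZ := integrable_centeredSum (S.integrable_logLik hg k')
  rw [hinv] at hWE₁
  set B := klSum P X s g k' + (2 + 2 * Real.exp τ / θ) * (L * Real.log K) + η +
    (1 + shellConst θ τ) * T + θ * T with hB
  refine ⟨fun ω => B - centeredSum P X (logLik s k' g) ω + W₁ ω + W₂ ω,
    (((integrable_const B).sub hZ).add hWi₁).add hWi₂, ?_, ?_⟩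
  · filter_upwards [hmin, hmap] with ω h1 h2
    have hf := h1.2.1
    refine ⟨hf, ?_⟩
    have h3 := S.klSum_le_of_isEtaMinimizer (k' := k') h1 h2 hg
    have h4 := S.centeredSum_logLik hf (hf₀ (kHat ω)) (kHat ω) ω
    have h5 := hb₁ (kHat ω) ω
    have h6 := hb₂ (kHat ω) _ hf ω
    have h7 := hnear (kHat ω) _ hf
    have h8 : 2 * (θ / (2 * Real.exp τ)) * Real.exp τ = θ := by field_simp
    have h9 : L * Real.log K / (θ / (2 * Real.exp τ)) =
        2 * Real.exp τ / θ * (L * Real.log K) := by field_simp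
    rw [h8, h9] at h5
    -- Used twice: the anchor loss enters with weight θ from the union bound and again from the
    -- peeling. With the θ of the estimator itself this is the 3θ moved to the left, and a slack 2θT
    -- ≤ θT + T.
    have h10 := mul_le_mul_of_nonneg_left h7 hθ.le
    have h11 := mul_le_mul_of_nonneg_right hθ1 (by linarith : 0 ≤ T)
    show _ ≤ B - centeredSum P X (logLik s k' g) ω + W₁ ω + W₂ ω
    rw [hB]
    linarith
  · have hi1 : Integrable (fun ω => B - centeredSum P X (logLik s k' g) ω) P :=
      (integrable_const B).sub hZ
    have hi2 : Integrable (fun ω => B - centeredSum P X (logLik s k' g) ω + W₁ ω) P := hi1.add hWi₁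
    rw [integral_add hi2 hWi₂, integral_add hi1 hWi₁, integral_sub (integrable_const B) hZ,
      integral_centeredSum (S.integrable_logLik hg k')]
    simp only [integral_const, probReal_univ, smul_eq_mul, one_mul, sub_zero]
    have : 2 * Real.exp τ / θ ≤ 2 * Real.exp τ / θ * T := le_mul_of_one_le_right (by positivity) hT
    rw [hB]
    linarith

/-- Oracle inequality when the complexity is small: there is only one assignment. -/
theorem Setting.exists_risk_bound_of_small (S : Setting P lam s X F τ)
    (hE : EntropyIntegralBound lam N s F φ) (hK : K = 1) {σ T η : ℝ} (hσ : 0 < σ)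
    (hTσ : T = total N * σ ^ 2) (hT : T < 1 / 32)
    (hφ : ∀ ρ, σ ≤ ρ → φ ρ ≤ ρ * Real.sqrt T)
    {pHat : Ω → Fin K → ℝ} {fHat : Ω → Fin K → 𝒳 → ℝ} {kHat : Ω → Fin L → Fin K}
    (hmin : ∀ᵐ ω ∂P, IsEtaMinimizer (fun l i => X ⟨l, i⟩ ω) F η (pHat ω) (fHat ω))
    (hmap : ∀ᵐ ω ∂P, IsMAP (fun l i => X ⟨l, i⟩ ω) (pHat ω) (fHat ω) (kHat ω))
    {g : Fin K → 𝒳 → ℝ} (hg : g ∈ F) (k' : Fin L → Fin K) :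
    ∃ R : Ω → ℝ, Integrable R P ∧
      (∀ᵐ ω ∂P, fHat ω ∈ F ∧ klSum P X s (fHat ω) (kHat ω) ≤ R ω) ∧
      ∫ ω, R ω ∂P ≤ klSum P X s g k' + η + 12 := by
  obtain ⟨W, hWi, hWE, hb⟩ := S.exists_small_bound hE hg k' hσ hTσ hT hφ
  refine ⟨fun ω => klSum P X s g k' + η + 10 + W ω, (integrable_const _).add hWi, ?_, ?_⟩
  · filter_upwards [hmin, hmap] with ω h1 h2
    have hf := h1.2.1
    refine ⟨hf, ?_⟩
    have h3 := S.klSum_le_of_isEtaMinimizer (k' := k') h1 h2 hg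
    subst hK
    have hk : kHat ω = k' := Subsingleton.elim _ _
    have h4 := S.centeredSum_logLik hf hg k' ω
    have h5 := hb _ hf ω
    rw [hk] at h3 ⊢
    simp only [Nat.cast_one, Real.log_one, mul_zero] at h3
    linarith
  · rw [integral_add (integrable_const _) hWi]
    simp only [integral_const, probReal_univ, smul_eq_mul, one_mul]
    linarith

/-- Oracle inequality for one competitor. -/
theorem Setting.lintegral_weightedKL_le_oracle (S : Setting P lam s X F τ)
    (hE : EntropyIntegralBound lam N s F φ) (hK : 0 < K) {C₁ σ η : ℝ} (hC : 1 < C₁) (hσ : 0 < σ)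
    (hη : 0 ≤ η) (hroot : φ σ / σ = Real.sqrt (total N) * σ)
    {pHat : Ω → Fin K → ℝ} {fHat : Ω → Fin K → 𝒳 → ℝ} {kHat : Ω → Fin L → Fin K}
    (hmin : ∀ᵐ ω ∂P, IsEtaMinimizer (fun l i => X ⟨l, i⟩ ω) F η (pHat ω) (fHat ω))
    (hmap : ∀ᵐ ω ∂P, IsMAP (fun l i => X ⟨l, i⟩ ω) (pHat ω) (fHat ω) (kHat ω))
    {g : Fin K → 𝒳 → ℝ} (hg : g ∈ F) (k' : Fin L → Fin K) :
    ∫⁻ ω, weightedKL lam N s (fHat ω) (kHat ω) ∂P ≤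
      ENNReal.ofReal ((C₁ * (klSum P X s g k' +
        ((2 + riskConst ((1 - 1 / C₁) / 3) τ) * (L * Real.log K) +
          riskConst ((1 - 1 / C₁) / 3) τ * (total N * σ ^ 2)) + η) + 12) / total N) := by
  have hn : (0 : ℝ) < total N := by exact_mod_cast S.total_pos
  have hC0 : 0 < C₁ := by linarith
  -- Chosen so that 1 - 3θ = 1/C₁.
  set θ := (1 - 1 / C₁) / 3 with hθdef
  have hCinv : 1 / C₁ < 1 := by rw [div_lt_one hC0]; exact hC
  have hCinv0 : 0 < 1 / C₁ := by positivity
  have hθ : 0 < θ := by rw [hθdef]; linarith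
  have hθ1 : θ ≤ 1 := by rw [hθdef]; linarith
  have h3θ : (1 - 3 * θ) * C₁ = 1 := by rw [hθdef]; field_simp; ring
  have hκ := riskConst_pos hθ τ
  set D := total N * σ ^ 2 with hD
  have hD0 : 0 < D := by positivity
  set Λ := L * Real.log K with hΛ
  have hΛ0 : 0 ≤ Λ := mul_nonneg (Nat.cast_nonneg _) (Real.log_natCast_nonneg _)
  have hφσ : ∀ ρ, σ ≤ ρ → φ ρ ≤ ρ * Real.sqrt D := fun ρ hρ => by
    have hρ0 : 0 < ρ := hσ.trans_le hρ
    have h1 : φ ρ / ρ ≤ φ σ / σ := hE.anti (Set.mem_Ioi.2 hσ) (Set.mem_Ioi.2 hρ0) hρ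
    rw [hroot, div_le_iff₀ hρ0] at h1
    rw [hD, Real.sqrt_mul hn.le, Real.sqrt_sq hσ.le]
    linarith
  have hkl := S.klSum_nonneg hg k'
  -- Below 1/32 the term L log K is less than log 2, so `K = 1`. Above it, T = 32(D + Λ) is at least
  -- 1 and absorbs additive constants.
  rcases lt_or_ge (D + Λ) (1 / 32) with hsmall | hlarge
  · have hK1 : K = 1 := by
      by_contra hne
      have hK2 : (2 : ℝ) ≤ K := by exact_mod_cast (by omega : 2 ≤ K)
      have hL : 1 ≤ L := by
        rcases Nat.eq_zero_or_pos L with h | h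
        · have := S.total_pos
          subst h
          simp [total] at this
        · exact h
      have h1 := Real.log_le_log two_pos hK2
      have h2 : (1 : ℝ) ≤ L := by exact_mod_cast hL
      have h3 := Real.log_two_gt_d9
      have h4 : Real.log K ≤ Λ := le_mul_of_one_le_left (by linarith) h2
      linarith
    obtain ⟨R, hR, hle, hint⟩ := S.exists_risk_bound_of_small hE hK1 hσ hD
      (by linarith) hφσ hmin hmap hg k'
    refine S.lintegral_weightedKL_le hR hle (hint.trans ?_)
    have h1 : 0 ≤ (2 + riskConst θ τ) * Λ + riskConst θ τ * D := by positivity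
    nlinarith
  · set T := 32 * (D + Λ) with hT
    have hT1 : 1 ≤ T := by rw [hT]; linarith
    obtain ⟨R, hR, hle, hint⟩ := S.exists_risk_bound_of_large hE hK (T := T) (θ := θ) hT1
      (by rw [hT]; linarith) hθ hθ1 (fun ρ hρ hTρ => by
        have h1 : σ ≤ ρ := by
          refine le_of_sq_le_sq ?_ hρ.le
          have : (total N : ℝ) * σ ^ 2 ≤ total N * ρ ^ 2 := by linarith
          exact le_of_mul_le_mul_left this hn
        refine (hφσ ρ h1).trans (mul_le_mul_of_nonneg_left (Real.sqrt_le_sqrt ?_) hρ.le)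
        linarith) hmin hmap hg k'
    refine S.lintegral_weightedKL_le (R := fun ω => C₁ * R ω) (hR.const_mul C₁) ?_ ?_
    · filter_upwards [hle] with ω hω
      refine ⟨hω.1, ?_⟩
      have h1 := mul_le_mul_of_nonneg_left hω.2 hC0.le
      have h2 : C₁ * ((1 - 3 * θ) * klSum P X s (fHat ω) (kHat ω)) =
          klSum P X s (fHat ω) (kHat ω) := by
        rw [← mul_assoc, mul_comm C₁, h3θ, one_mul]
      linarith
    · rw [integral_const_mul]
      have h1 : ∫ ω, R ω ∂P ≤ klSum P X s g k' +
          ((2 + riskConst θ τ) * Λ + riskConst θ τ * D) + η := by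
        have h3 : θ * T ≤ T := mul_le_of_le_one_left (by linarith) hθ1
        have h4 : 0 ≤ 2 * Real.exp τ / θ * D := by positivity
        -- The definition of `riskConst` expanded; the final D term is surplus, present because one
        -- constant multiplies both Λ and D.
        have h5 : (2 + riskConst θ τ) * Λ + riskConst θ τ * D =
            (2 + 2 * Real.exp τ / θ) * Λ + (1 + shellConst θ τ + (1 / shellParam θ τ + 2) +
              2 * Real.exp τ / θ) * T + T + 2 * Real.exp τ / θ * D := by
          rw [hT]; unfold riskConst; ring
        linarith
      have h2 := mul_le_mul_of_nonneg_left h1 hC0.le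
      linarith

end Risk

end MixtureRisk

/-! ### The oracle inequality for the infimum over competitors -/

theorem mainTheorem4 (C₁ : ℝ) (hC₁ : 1 < C₁) :
    ∃ C₂ : ℝ, 0 < C₂ ∧ ∃ κ₀ : ℝ → ℝ, (∀ τ, 0 < κ₀ τ) ∧
    ∀ (𝒳 : Type*) [MeasurableSpace 𝒳] (lam : Measure 𝒳)
      (Ω : Type*) [MeasurableSpace Ω] (P : Measure Ω) [IsProbabilityMeasure P]
      (L K : ℕ) (N : Fin L → ℕ) (s : Fin L → 𝒳 → ℝ)
      (X : (l : Fin L) → Fin (N l) → Ω → 𝒳)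
      (F : Set (Fin K → 𝒳 → ℝ)) (τ : ℝ) (φ : ℝ → ℝ) (σ η : ℝ)
      (pHat : Ω → Fin K → ℝ) (fHat : Ω → Fin K → 𝒳 → ℝ) (kHat : Ω → Fin L → Fin K),
      0 < MixtureRisk.total N →
      -- the observations: independent, `X l i` with density `s l`
      (∀ l, MixtureRisk.IsDensity lam (s l)) →
      (∀ l i, HasLaw (X l i) (MixtureRisk.law lam (s l)) P) →
      iIndepFun (fun q : (l : Fin L) × Fin (N l) => X q.1 q.2) P →
      -- the model and its three assumptions
      MixtureRisk.IsModel lam F →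
      MixtureRisk.RatioBound F s τ →
      MixtureRisk.EntropyIntegralBound lam N s F φ →
      MixtureRisk.Separable lam F →
      -- the root `σ` of `φ(σ) / σ = √n σ`
      0 < σ →
      φ σ / σ = Real.sqrt (MixtureRisk.total N) * σ →
      -- the estimator and the assignment
      0 ≤ η →
      (∀ᵐ ω ∂P, MixtureRisk.IsEtaMinimizer (fun l i => X l i ω) F η (pHat ω) (fHat ω)) →
      (∀ᵐ ω ∂P, MixtureRisk.IsMAP (fun l i => X l i ω) (pHat ω) (fHat ω) (kHat ω)) →
      AEMeasurable (fun ω => MixtureRisk.weightedKL lam N s (fHat ω) (kHat ω)) P →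
      ∫⁻ ω, MixtureRisk.weightedKL lam N s (fHat ω) (kHat ω) ∂P ≤
        ENNReal.ofReal C₁ *
          ((⨅ (f ∈ F) (k : Fin L → Fin K), MixtureRisk.weightedKL lam N s f k) +
            ENNReal.ofReal
              (((2 + κ₀ τ) * (L * Real.log K) + κ₀ τ * (MixtureRisk.total N * σ ^ 2)) /
                MixtureRisk.total N + η / MixtureRisk.total N)) +
        ENNReal.ofReal (C₂ / MixtureRisk.total N) := by
  -- 12 = 10 + 2 comes from the small complexity regime, the only one that needs an additive
  -- constant.
  refine ⟨12, by norm_num, MixtureRisk.riskConst ((1 - 1 / C₁) / 3), fun τ => ?_, ?_⟩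
  · refine MixtureRisk.riskConst_pos ?_ τ
    have : 1 / C₁ < 1 := by rw [div_lt_one (by linarith)]; exact hC₁
    linarith
  intro 𝒳 _ lam Ω _ P _ L K N s X F τ φ σ η pHat fHat kHat hn hs hlaw hind hmodel hratio hE _ hσ
    hroot hη hmin hmap _
  -- One sample point with a minimizer shows that the simplex and the model are nonempty; comparing
  -- a density with itself at an observation then forces τ ≥ 0.
  obtain ⟨ω, hω⟩ := hmin.exists
  have hK : 0 < K := by
    rcases Nat.eq_zero_or_pos K with h | h
    · subst h
      have := hω.1.2
      simp at this
    · exact h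
  have hτ : 0 ≤ τ := by
    obtain ⟨l, hl⟩ : ∃ l, 0 < N l := by
      by_contra! hc
      simp [MixtureRisk.total, fun l => Nat.le_zero.1 (hc l)] at hn
    have h1 := (hratio.1 _ hω.2.1 _ hω.2.1 ⟨0, hK⟩ (X l ⟨0, hl⟩ ω)).1
    have h2 := (hmodel _ hω.2.1 ⟨0, hK⟩).2 (X l ⟨0, hl⟩ ω)
    have h3 : Real.exp (-τ) ≤ 1 := le_of_mul_le_mul_right (by linarith) h2
    linarith [Real.exp_le_one_iff.1 h3]
  have S : MixtureRisk.Setting P lam s (fun q : (l : Fin L) × Fin (N l) => X q.1 q.2) F τ :=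
    ⟨fun q => hlaw q.1 q.2, hind, hs, hmodel, hratio, hτ, hn⟩
  have hn' : (0 : ℝ) < MixtureRisk.total N := by exact_mod_cast hn
  have hC0 : 0 < C₁ := by linarith
  -- The infima over the density, its membership and the assignment are pulled out one at a time,
  -- leaving the inequality for a single competitor.
  rw [ENNReal.iInf_add, ENNReal.mul_iInf_of_ne (ENNReal.ofReal_pos.2 hC0).ne' ENNReal.ofReal_ne_top,
    ENNReal.iInf_add]
  refine le_iInf fun g => ?_
  rw [ENNReal.iInf_add, ENNReal.mul_iInf_of_ne (ENNReal.ofReal_pos.2 hC0).ne' ENNReal.ofReal_ne_top,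
    ENNReal.iInf_add]
  refine le_iInf fun hg => ?_
  rw [ENNReal.iInf_add, ENNReal.mul_iInf_of_ne (ENNReal.ofReal_pos.2 hC0).ne' ENNReal.ofReal_ne_top,
    ENNReal.iInf_add]
  refine le_iInf fun k' => ?_
  refine (S.lintegral_weightedKL_le_oracle hE hK hC₁ hσ hη hroot hmin hmap hg k').trans ?_
  have hκ : 0 < MixtureRisk.riskConst ((1 - 1 / C₁) / 3) τ := by
    refine MixtureRisk.riskConst_pos ?_ τ
    have : 1 / C₁ < 1 := by rw [div_lt_one hC0]; exact hC₁
    linarith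
  have hΛ : 0 ≤ L * Real.log K := mul_nonneg (Nat.cast_nonneg _) (Real.log_natCast_nonneg _)
  have hkl := S.klSum_nonneg hg k'
  rw [S.weightedKL_eq hg, ← ENNReal.ofReal_add (by positivity) (by positivity),
    ← ENNReal.ofReal_mul hC0.le, ← ENNReal.ofReal_add (by positivity) (by positivity)]
  refine ENNReal.ofReal_le_ofReal (le_of_eq ?_)
  ring
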